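/- Let $J$ be a Polish space and $\Phi$ a simple point process on $J$ (a random measure that is almost surely a locally finite, $\{0,1,2,\dots,\infty\}$-valued measure with atoms of mass at most one), with mean measure $\mu(B)=\mathbb E\,\Phi(B)$ and $\mu(J)<\infty$. Let $(\Phi_\alpha)_{\alpha\in J}$ be Palm processes of $\Phi$, i.e. random measures whose laws form a probability kernel such that $$\mathbb E\int_J h(\alpha,\Phi)\,\Phi(d\alpha)=\int_J \mathbb E\,h(\alpha,\Phi_\alpha)\,\mu(d\alpha)\qquad\text{for all measurable } h\ge 0 .$$ For every $\alpha\in J$ let $A_\alpha\subset B_\alpha\subset J$ be measurable sets such that for $\mu$-almost every $\alpha$: 1. $\mathcal L(\Phi_\alpha(A_\alpha^c))=\mathcal L(\Phi(A_\alpha^c))$ and $\mathcal L(\Phi_\alpha(B_\alpha^c))=\mathcal L(\Phi(B_\alpha^c))$ (both hold, for instance, if $\Phi_\alpha|_{A_\alpha^c}$ and $\Phi|_{A_\alpha^c}$ have the same law); 2. $\Phi_\alpha(A_\alpha)$ and $\Phi_\alpha(B_\alpha^c)$ are independent; 3. $\Phi(A_\alpha)$ and $\Phi(B_\alpha^c)$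 are independent. Let $W=\Phi(J)-\mu(J)$ and suppose that $\sigma^2:=\operatorname{Var}W$ is finite and $\sigma^2>1$. Writing $\langle x\rangle=x-\lfloor x\rfloor$, put $a=-\mu(J)$, $\delta=\langle-4\sigma^2\rangle$ and $t=\langle a+2\sigma^2+\delta/2\rangle/(4\sigma^2+\delta)$, and let $\widehat{\mathrm{Bi}}(n,p)$ be the binomial distribution with $n$ trials of success probability $p$, shifted by $-np$. Let $$d_1(P,Q)=\sup_{A\subset\mathbb R\ \text{Borel}}|P(A)-Q(A)|,\qquad d_2(P,Q)=\sup_{x\in\mathbb R}\bigl|P([x,x+1))-Q([x,x+1))\bigr| ,$$ and $D^l(\nu)=\|\nu*(\delta_1-\delta_0)^{*l}\|$, with $\|\cdot\|$ the variation norm and $\delta_x$ the unit mass at $x$; write $D^l(X\mid Y)$ for the random variable $D^l(\mathcal L(X\mid Y))$, where $\mathcal L(X\mid Y)$ is a regular conditional distribution. Then, for $l=1,2$, $$d_l\bigl(\mathcal L(W),\widehat{\mathrm{Bi}}(\lceil4\sigma^2\rceil,\tfrac12-t)\bigr)\le\sigma^{-2}\int_J\vartheta_l(\alpha)\,\mu(d\alpha)+1.75\,\sigma^{-2},$$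 where, with $\Phi'=\Phi-\mu$ and $\Phi'_\alpha=\Phi_\alpha-\mu$, $$\begin{aligned}\vartheta_l(\alpha)={}&|\mathbb E\Phi'_\alpha(A_\alpha)|\;\mathbb E\{|\Phi'(B_\alpha)|\,D^l(\Phi(B_\alpha^c)\mid\Phi(B_\alpha))\}\\&+\tfrac12\mathbb E\{\Phi'_\alpha(A_\alpha)^2D^l(\Phi_\alpha(A_\alpha^c)\mid\Phi_\alpha(A_\alpha))\}+\tfrac12\mathbb E\{\Phi'(A_\alpha)^2D^l(\Phi(A_\alpha^c)\mid\Phi(A_\alpha))\}\\&+\mathbb E\{|\Phi'_\alpha(A_\alpha)\Phi'_\alpha(B_\alpha\setminus A_\alpha)|\,D^l(\Phi_\alpha(B_\alpha^c)\mid\Phi_\alpha(A_\alpha),\Phi_\alpha(B_\alpha))\}\\&+\mathbb E\{|\Phi'(A_\alpha)\Phi'(B_\alpha\setminus A_\alpha)|\,D^l(\Phi(B_\alpha^c)\mid\Phi(A_\alpha),\Phi(B_\alpha))\}.\end{aligned}$$ The right-hand side may be $+\infty$. -/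

import Mathlib

open MeasureTheory ProbabilityTheory Set
open scoped ENNReal

noncomputable section

/-! ### Distances and smoothness of distributions on the line -/

/-- Total variation distance `sup_A |P(A) - Q(A)|`, over Borel sets `A`. -/
def dTV (P Q : Measure ℝ) : ℝ≥0∞ :=
  ⨆ (A : Set ℝ) (_ : MeasurableSet A), ENNReal.ofReal |P.real A - Q.real A|

/-- Local limit distance `sup_x |P([x, x+1)) - Q([x, x+1))|`. -/
def dLoc (P Q : Measure ℝ) : ℝ≥0∞ :=
  ⨆ x : ℝ, ENNReal.ofReal |P.real (Ico x (x + 1)) - Q.real (Ico x (x + 1))|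

/-- The metrics `d_1 = d_TV` and `d_2 = d_loc` (only these two indices are used). -/
def dMetric (l : ℕ) (P Q : Measure ℝ) : ℝ≥0∞ :=
  if l = 1 then dTV P Q else dLoc P Q

/-- Convolution of a signed measure `s` on `ℝ` with `δ₁ - δ₀`. -/
def convDiff (s : SignedMeasure ℝ) : SignedMeasure ℝ :=
  s.map (fun x : ℝ => x + 1) - s

/-- `D^l(ν) = ‖ν * (δ₁ - δ₀)^{*l}‖`, the norm being the variation norm (total mass of the
total variation measure). -/
def smoothD (l : ℕ) (ν : Measure ℝ) [IsFiniteMeasure ν] : ℝ≥0∞ :=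
  (convDiff^[l] ν.toSignedMeasure).totalVariation univ

/-- The random variable `D^l(ℒ(X | Y))`, with `ℒ(X | Y)` a regular conditional distribution. -/
def condD {Ω β : Type*} [MeasurableSpace Ω] [MeasurableSpace β] (l : ℕ) (X : Ω → ℝ) (Y : Ω → β)
    (P : Measure Ω) [IsFiniteMeasure P] (ω : Ω) : ℝ≥0∞ :=
  smoothD l (condDistrib X Y P (Y ω))

/-! ### The approximating binomial distribution -/

/-- The binomial distribution with `n` trials of success probability `p`, shifted by `-np`. -/
def centeredBinomial (n : ℕ) (p : unitInterval) : Measure ℝ :=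
  (binomial n p).map (fun k : ℕ => (k : ℝ) - n * p)

/-- `δ = ⟨-4σ²⟩`, as a function of `v = σ²`; thus `4σ² + δ = ⌈4σ²⌉`. -/
def deltaParam (v : ℝ) : ℝ := Int.fract (-(4 * v))

/-- `t = ⟨a + 2σ² + δ/2⟩ / (4σ² + δ)`, as a function of `a` and `v = σ²`. -/
def tParam (a v : ℝ) : ℝ :=
  Int.fract (a + 2 * v + deltaParam v / 2) / (4 * v + deltaParam v)

theorem half_sub_tParam_mem (a v : ℝ) (hv : 1 < v) : 1 / 2 - tParam a v ∈ unitInterval := by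
  have hd : 0 ≤ deltaParam v := Int.fract_nonneg _
  have h0 := Int.fract_nonneg (a + 2 * v + deltaParam v / 2)
  have h1 := Int.fract_lt_one (a + 2 * v + deltaParam v / 2)
  have hpos : 0 < 4 * v + deltaParam v := by linarith
  have ht0 : 0 ≤ tParam a v := div_nonneg h0 hpos.le
  have ht1 : tParam a v ≤ 1 / 2 := by
    unfold tParam
    rw [div_le_iff₀ hpos]
    linarith
  exact ⟨by linarith, by linarith⟩

/-- The success probability `1/2 - t`. -/
def successProb (a v : ℝ) (hv : 1 < v) : unitInterval :=
  ⟨1 / 2 - tParam a v, half_sub_tParam_mem a v hv⟩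

/-! ### Point processes and Palm processes -/

section PointProcess

variable {Ω J : Type*} [MeasurableSpace Ω] [MeasurableSpace J]

/-- A simple point measure: a locally finite measure with values in `{0, 1, 2, …, ∞}`
whose atoms have mass one. -/
structure IsSimplePointMeasure [TopologicalSpace J] (ν : Measure J) : Prop where
  locallyFinite : IsLocallyFiniteMeasure ν
  integerValued : ∀ B : Set J, MeasurableSet B → ∃ k : ℕ∞, ν B = (k : ℝ≥0∞)
  simple : ∀ x : J, ν {x} ≤ 1

/-- A simple point process on `J`, as a random measure that is almost surely a simple point
measure. The σ-algebra on `Measure J` is the one generated by the evaluations `ν ↦ ν B`. -/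
structure IsSimplePointProcess [TopologicalSpace J] (Φ : Ω → Measure J) (P : Measure Ω) :
    Prop where
  measurable : Measurable Φ
  ae_simple : ∀ᵐ ω ∂P, IsSimplePointMeasure (Φ ω)

/-- The mean measure `μ(B) = 𝔼 Φ(B)`. -/
def meanMeasure (Φ : Ω → Measure J) (P : Measure Ω) : Measure J := P.bind Φ

/-- `κ α` is the law of the Palm process `Φ_α` of `Φ` at `α`: the family `κ` disintegrates the
Campbell measure of `Φ` with respect to the mean measure `μ`, that is
`𝔼 ∫ h(α, Φ) Φ(dα) = ∫ 𝔼 h(α, Φ_α) μ(dα)` for all measurable `h ≥ 0`. In particular `Φ_α` counts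
the point at `α`. -/
def IsPalmKernel (Φ : Ω → Measure J) (P : Measure Ω) (κ : Kernel J (Measure J)) : Prop :=
  ∀ h : J → Measure J → ℝ≥0∞, Measurable (Function.uncurry h) →
    ∫⁻ ω, ∫⁻ α, h α (Φ ω) ∂(Φ ω) ∂P = ∫⁻ α, ∫⁻ ν, h α ν ∂(κ α) ∂(meanMeasure Φ P)

/-- The number `Ψ(B)` of points of `Ψ` in `B`, as a real random variable. -/
def pointCount (Ψ : Ω → Measure J) (B : Set J) (ω : Ω) : ℝ := (Ψ ω B).toReal

/-- The centred number `Ψ'(B) = Ψ(B) - μ(B)`. -/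
def centred (Ψ : Ω → Measure J) (μ : Measure J) (B : Set J) (ω : Ω) : ℝ :=
  pointCount Ψ B ω - (μ B).toReal

/-- `𝔼{Ψ'(A)² D^l(ℒ(Ψ(Aᶜ) | Ψ(A)))}`. -/
def squareTerm (l : ℕ) (Ψ : Ω → Measure J) (P : Measure Ω) [IsFiniteMeasure P] (μ : Measure J)
    (A : Set J) : ℝ≥0∞ :=
  ∫⁻ ω, ENNReal.ofReal (centred Ψ μ A ω ^ 2) * condD l (pointCount Ψ Aᶜ) (pointCount Ψ A) P ω ∂P

/-- `𝔼{|Ψ'(A) Ψ'(B \ A)| D^l(ℒ(Ψ(Bᶜ) | Ψ(A), Ψ(B)))}`. -/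
def crossTerm (l : ℕ) (Ψ : Ω → Measure J) (P : Measure Ω) [IsFiniteMeasure P] (μ : Measure J)
    (A B : Set J) : ℝ≥0∞ :=
  ∫⁻ ω, ENNReal.ofReal |centred Ψ μ A ω * centred Ψ μ (B \ A) ω| *
    condD l (pointCount Ψ Bᶜ) (fun ω' => (pointCount Ψ A ω', pointCount Ψ B ω')) P ω ∂P

/-- `𝔼{|Ψ'(B)| D^l(ℒ(Ψ(Bᶜ) | Ψ(B)))}`. -/
def absTerm (l : ℕ) (Ψ : Ω → Measure J) (P : Measure Ω) [IsFiniteMeasure P] (μ : Measure J)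
    (B : Set J) : ℝ≥0∞ :=
  ∫⁻ ω, ENNReal.ofReal |centred Ψ μ B ω| * condD l (pointCount Ψ Bᶜ) (pointCount Ψ B) P ω ∂P

/-- The quantity `ϑ_l(α)` for the sets `A = A_α`, `B = B_α`, where `Q` is the law of the Palm
process `Φ_α`, which is realised as the identity map on the probability space
`(Measure J, Q)`. -/
def theta (l : ℕ) (Φ : Ω → Measure J) (P : Measure Ω) [IsFiniteMeasure P]
    (Q : Measure (Measure J)) [IsFiniteMeasure Q] (A B : Set J) : ℝ≥0∞ :=
  let μ := meanMeasure Φ P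
  ENNReal.ofReal |∫ ν, centred id μ A ν ∂Q| * absTerm l Φ P μ B
    + 1 / 2 * squareTerm l id Q μ A
    + 1 / 2 * squareTerm l Φ P μ A
    + crossTerm l id Q μ A B
    + crossTerm l Φ P μ A B

/-- `W = Φ(J) - μ(J)`. -/
def totalCentred (Φ : Ω → Measure J) (P : Measure Ω) : Ω → ℝ :=
  centred Φ (meanMeasure Φ P) univ

end PointProcess

end

/-! The argument is Stein's method for a binomial target with `p` close to `1/2`. For a set `T` of
lattice points, the discrete Stein equation `(1-p) k γ(k) - p (n-k) γ(k+1) = 1_T(k) - Bi(T)` has a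
solution vanishing outside `1, …, n`, with increments bounded by `1/((n+1)p(1-p)) ≤ σ⁻²`; for `T`
with at most one point, `γ` itself has the same bound (`BinomialStein.exists_solution`,
`inv_stein_const_le`).

The centred counts `Φ'(A)` are not integers, so a Taylor expansion needs a function on the whole
line. Let `F` be the quadratic spline with coefficients `γ`: at an integer `k` it is the mean of
`γ(k)` and `γ(k+1)`, its derivative there is `γ(k+1) - γ(k)`, and off the integers its second
derivative is a second difference of a step function. Since `p = 1/2 - t`, the Stein operator at `w
= k - np` equals `w F - σ² F'` up to a multiple of `γ(k+1) - γ(k)` with factor `-t w + σ² -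
np(1-p)`. Such errors, together with the event that `W` leaves the range of the binomial, cost
`O(σ⁻²)` (`abs_stein_error_le`, `abs_measureReal_sub_le`). The choice of `t` makes `np` congruent to
`μ(J)` modulo one, so that `W` and the binomial share a lattice.

It remains to bound `E W F(W) - σ² E F'(W)`. With `W_α = Φ_α(J) - μ(J)`, the Palm identity turns
this into the `μ`-integral of `E F(W_α) - E F(W) - E W_α · E F'(W)` (`ofReal_abs_stein_le`). For
fixed `α`, expand `F` around the count outside `A_α` and move the argument of `F'` to the count
outside `B_α`. Equality of laws and independence cancel the principal terms; the five remainders are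
those of `ϑ_l(α)` (`ofReal_abs_palm_remainder_le`). Each is averaged over a conditional law `ν` of
an outer count, and the second difference in `F''` is passed on to `ν`: one difference for `l = 1`,
both for `l = 2`, which produces `D^l(ν)` (`isSmoothTest_interp`). -/

noncomputable section

/-! ### The Stein equation of the binomial distribution -/

namespace BinomialStein

/-- The mass of the binomial distribution at `k`. -/
def weight (n : ℕ) (p : ℝ) (k : ℕ) : ℝ := n.choose k * p ^ k * (1 - p) ^ (n - k)

theorem weight_nonneg {n : ℕ} {p : ℝ} (h0 : 0 < p) (h1 : p < 1) (k : ℕ) : 0 ≤ weight n p k := by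
  have : 0 < 1 - p := by linarith
  unfold weight; positivity

theorem weight_pos {n : ℕ} {p : ℝ} (h0 : 0 < p) (h1 : p < 1) {k : ℕ} (hk : k ≤ n) :
    0 < weight n p k := by
  have : 0 < 1 - p := by linarith
  have : 0 < n.choose k := Nat.choose_pos hk
  unfold weight; positivity

theorem weight_eq_zero {n : ℕ} {p : ℝ} {k : ℕ} (hk : n < k) : weight n p k = 0 := by
  simp [weight, Nat.choose_eq_zero_of_lt hk]

theorem sum_weight (n : ℕ) (p : ℝ) : ∑ k ∈ Finset.range (n + 1), weight n p k = 1 := by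
  have h := add_pow p (1 - p) n
  rw [add_sub_cancel, one_pow] at h
  rw [h]
  refine Finset.sum_congr rfl fun k _ => ?_
  unfold weight; ring

theorem weight_balance (n : ℕ) (p : ℝ) (k : ℕ) :
    (1 - p) * (k + 1) * weight n p (k + 1) = p * (n - k) * weight n p k := by
  rcases lt_trichotomy k n with h | rfl | h
  · obtain ⟨m, rfl⟩ := Nat.exists_eq_add_of_lt h
    have hc := Nat.choose_succ_right_eq (k + m + 1) k
    have hc' : ((k + m + 1).choose (k + 1) : ℝ) * (k + 1) = (k + m + 1).choose k * (m + 1) := by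
      have : k + m + 1 - k = m + 1 := by omega
      rw [this] at hc
      exact_mod_cast hc
    have e1 : k + m + 1 - (k + 1) = m := by omega
    have e2 : k + m + 1 - k = m + 1 := by omega
    unfold weight
    rw [e1, e2]
    push_cast
    linear_combination (1 - p) ^ (m + 1) * p ^ (k + 1) * hc'
  · simp [weight_eq_zero (n := k) (p := p) (Nat.lt_succ_self k)]
  · rw [weight_eq_zero h, weight_eq_zero (by omega)]; simp

theorem weight_eq_weight_succ_succ (n : ℕ) (p : ℝ) (k : ℕ) :
    (n + 1) * p * weight n p k = (k + 1) * weight (n + 1) p (k + 1) := by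
  have hc : ((n : ℝ) + 1) * n.choose k = (n + 1).choose (k + 1) * (k + 1) := by
    exact_mod_cast Nat.add_one_mul_choose_eq n k
  unfold weight
  rw [Nat.add_sub_add_right]
  linear_combination p ^ (k + 1) * (1 - p) ^ (n - k) * hc

theorem weight_eq_weight_succ (n : ℕ) (p : ℝ) {k : ℕ} (hk : k ≤ n) :
    (n + 1) * (1 - p) * weight n p k = (n + 1 - k) * weight (n + 1) p k := by
  obtain ⟨m, rfl⟩ := Nat.exists_eq_add_of_le hk
  have hc := Nat.choose_mul_succ_eq (k + m) k
  have e1 : k + m + 1 - k = m + 1 := by omega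
  have e2 : k + m - k = m := by omega
  rw [e1] at hc
  have hc' : ((k + m).choose k : ℝ) * (k + m + 1) = (k + m + 1).choose k * (m + 1) := by
    exact_mod_cast hc
  unfold weight
  rw [e1, e2]
  push_cast
  linear_combination p ^ k * (1 - p) ^ (m + 1) * hc'

/-! ### Monotone tail ratios of the binomial weights -/

/-- Ratio of the lower tail to the death flow at `k`. -/
def lowerRatio (n : ℕ) (p : ℝ) (k : ℕ) : ℝ :=
  (∑ i ∈ Finset.range k, weight n p i) / ((1 - p) * k * weight n p k)

/-- Ratio of the upper tail to the death flow at `k`. -/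
def upperRatio (n : ℕ) (p : ℝ) (k : ℕ) : ℝ :=
  (∑ i ∈ Finset.Ico k (n + 1), weight n p i) / ((1 - p) * k * weight n p k)

variable {n : ℕ} {p : ℝ}

theorem lowerRatio_nonneg (h0 : 0 < p) (h1 : p < 1) (k : ℕ) : 0 ≤ lowerRatio n p k := by
  have : 0 < 1 - p := by linarith
  have := weight_nonneg (n := n) h0 h1
  exact div_nonneg (Finset.sum_nonneg fun i _ => this i) (by have := this k; positivity)

theorem upperRatio_nonneg (h0 : 0 < p) (h1 : p < 1) (k : ℕ) : 0 ≤ upperRatio n p k := by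
  have : 0 < 1 - p := by linarith
  have := weight_nonneg (n := n) h0 h1
  exact div_nonneg (Finset.sum_nonneg fun i _ => this i) (by have := this k; positivity)

theorem flow_pos (h0 : 0 < p) (h1 : p < 1) {k : ℕ} (hk : 1 ≤ k) (hkn : k ≤ n) :
    0 < (1 - p) * k * weight n p k := by
  have : 0 < 1 - p := by linarith
  have := weight_pos h0 h1 hkn
  have : (0 : ℝ) < k := by exact_mod_cast hk
  positivity

theorem flow_succ (k : ℕ) :
    (1 - p) * ((k + 1 : ℕ) : ℝ) * weight n p (k + 1) = p * (n - k) * weight n p k := by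
  rw [← weight_balance]; push_cast; ring

/-- Log-concavity of the weights in exact form: the sign of the difference is that of the last
factor, which is positive for `i < k` and nonpositive for `k ≤ i ≤ n`. Monotonicity of both tail
ratios follows term by term. -/
theorem cross_diff (i k : ℕ) :
    (1 - p) * (i + 1) * (weight n p (i + 1) * ((1 - p) * k * weight n p k)
      - weight n p i * ((1 - p) * ((k + 1 : ℕ) : ℝ) * weight n p (k + 1)))
    = (1 - p) * p * weight n p i * weight n p k * ((n + 1) * ((k : ℝ) - (i + 1)) + (i + 1)) := by
  have h1 := weight_balance n p i
  rw [flow_succ]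
  linear_combination (1 - p) * k * weight n p k * h1

theorem cross_le (h0 : 0 < p) (h1 : p < 1) {i k : ℕ} (h : i < k) :
    weight n p i * ((1 - p) * ((k + 1 : ℕ) : ℝ) * weight n p (k + 1)) ≤
      weight n p (i + 1) * ((1 - p) * k * weight n p k) := by
  have hq : 0 < 1 - p := by linarith
  have hi : (i : ℝ) + 1 ≤ k := by exact_mod_cast h
  have := cross_diff (n := n) (p := p) i k
  have hw := weight_nonneg (n := n) h0 h1
  have h3 : 0 ≤ (1 - p) * p * weight n p i * weight n p k *
      ((n + 1) * ((k : ℝ) - (i + 1)) + (i + 1)) := by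
    have := hw i
    have := hw k
    have : 0 ≤ (k : ℝ) - (i + 1) := by linarith
    positivity
  rw [← this] at h3
  have := nonneg_of_mul_nonneg_right h3 (by positivity)
  linarith

theorem cross_ge (h0 : 0 < p) (h1 : p < 1) {i k : ℕ} (h : k ≤ i) (hi : i ≤ n) :
    weight n p (i + 1) * ((1 - p) * k * weight n p k) ≤
      weight n p i * ((1 - p) * ((k + 1 : ℕ) : ℝ) * weight n p (k + 1)) := by
  have hq : 0 < 1 - p := by linarith
  have hi' : (k : ℝ) ≤ i := by exact_mod_cast h
  have hin : (i : ℝ) ≤ n := by exact_mod_cast hi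
  have := cross_diff (n := n) (p := p) i k
  have hw := weight_nonneg (n := n) h0 h1
  have h3 : 0 ≤ (1 - p) * p * weight n p i * weight n p k *
      -((n + 1) * ((k : ℝ) - (i + 1)) + (i + 1)) := by
    have := hw i
    have := hw k
    have : 0 ≤ -((n + 1) * ((k : ℝ) - (i + 1)) + (i + 1)) := by nlinarith
    positivity
  rw [mul_neg, ← this, ← mul_neg] at h3
  have := nonneg_of_mul_nonneg_right h3 (by positivity)
  linarith

theorem lowerRatio_le_succ (h0 : 0 < p) (h1 : p < 1) {k : ℕ} (hk : k + 1 ≤ n) :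
    lowerRatio n p k ≤ lowerRatio n p (k + 1) := by
  rcases Nat.eq_zero_or_pos k with rfl | hk0
  · simpa [lowerRatio] using lowerRatio_nonneg (n := n) h0 h1 1
  unfold lowerRatio
  rw [div_le_div_iff₀ (flow_pos h0 h1 hk0 (by omega)) (flow_pos h0 h1 (by omega) hk),
    Finset.sum_mul, Finset.sum_mul, Finset.sum_range_succ']
  refine le_add_of_le_of_nonneg (Finset.sum_le_sum fun i hi => ?_) ?_
  · exact cross_le h0 h1 (Finset.mem_range.1 hi)
  · exact mul_nonneg (weight_nonneg h0 h1 _) (flow_pos h0 h1 hk0 (by omega)).le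

theorem upperRatio_succ_le (h0 : 0 < p) (h1 : p < 1) {k : ℕ} (hk : 1 ≤ k) (hkn : k ≤ n) :
    upperRatio n p (k + 1) ≤ upperRatio n p k := by
  rcases hkn.eq_or_lt with rfl | hlt
  · simpa [upperRatio] using upperRatio_nonneg (n := k) h0 h1 k
  unfold upperRatio
  rw [div_le_div_iff₀ (flow_pos h0 h1 (by omega) hlt) (flow_pos h0 h1 hk hkn),
    ← Finset.sum_Ico_add' _ k n 1, Finset.sum_Ico_succ_top hkn, Finset.sum_mul, add_mul,
    Finset.sum_mul]
  refine le_add_of_le_of_nonneg (Finset.sum_le_sum fun i hi => ?_) ?_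
  · rw [Finset.mem_Ico] at hi
    exact cross_ge h0 h1 hi.1 hi.2.le
  · exact mul_nonneg (weight_nonneg h0 h1 _) (flow_pos h0 h1 (by omega) hlt).le

theorem lowerRatio_mono (h0 : 0 < p) (h1 : p < 1) {k j : ℕ} (hkj : k ≤ j) (hj : j ≤ n) :
    lowerRatio n p k ≤ lowerRatio n p j := by
  induction j, hkj using Nat.le_induction with
  | base => exact le_rfl
  | succ m hm ih => exact (ih (by omega)).trans (lowerRatio_le_succ h0 h1 hj)

theorem upperRatio_anti (h0 : 0 < p) (h1 : p < 1) {k j : ℕ} (hk : 1 ≤ k) (hkj : k ≤ j)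
    (hj : j ≤ n + 1) : upperRatio n p j ≤ upperRatio n p k := by
  induction j, hkj using Nat.le_induction with
  | base => exact le_rfl
  | succ m hm ih =>
    exact (upperRatio_succ_le h0 h1 (by omega) (by omega)).trans (ih (by omega))

/-- Passing from `n` to `n + 1` trials absorbs the denominators: the lower tail is dominated by
binomial weights at `1, …, j` and the upper tail by those at `j + 1, …, n`. These index sets are
disjoint, so the total mass is at most one. This is the source of `n + 1` in the constant. -/
theorem weight_mul_ratios_le (h0 : 0 < p) (h1 : p < 1) {j : ℕ} (hj : j ≤ n) :
    weight n p j * (upperRatio n p (j + 1) + lowerRatio n p j) ≤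
      1 / ((n + 1) * (p * (1 - p))) := by
  have hq : 0 < 1 - p := by linarith
  set c : ℝ := (n + 1) * (p * (1 - p)) with hc
  have hcpos : 0 < c := by positivity
  have hw' := weight_nonneg (n := n + 1) h0 h1
  have hL : weight n p j * lowerRatio n p j ≤
      (∑ i ∈ Finset.range j, weight (n + 1) p (i + 1)) / c := by
    rcases Nat.eq_zero_or_pos j with rfl | hj0
    · simp [lowerRatio]
    have hjr : (0 : ℝ) < j := by exact_mod_cast hj0
    have hwj := weight_pos h0 h1 hj
    have e : weight n p j * lowerRatio n p j =
        (∑ i ∈ Finset.range j, weight n p i) / ((1 - p) * j) := by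
      unfold lowerRatio; field_simp
    rw [e, div_le_div_iff₀ (by positivity) hcpos, Finset.sum_mul, Finset.sum_mul]
    refine Finset.sum_le_sum fun i hi => ?_
    have hij : (i : ℝ) + 1 ≤ j := by exact_mod_cast Finset.mem_range.1 hi
    have := weight_eq_weight_succ_succ n p i
    calc weight n p i * c = (1 - p) * ((n + 1) * p * weight n p i) := by rw [hc]; ring
      _ = (1 - p) * ((i + 1) * weight (n + 1) p (i + 1)) := by rw [this]
      _ ≤ (1 - p) * (j * weight (n + 1) p (i + 1)) := by
        have := hw' (i + 1)
        gcongr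
      _ = _ := by ring
  have hU : weight n p j * upperRatio n p (j + 1) ≤
      (∑ i ∈ Finset.Ico (j + 1) (n + 1), weight (n + 1) p i) / c := by
    rcases hj.eq_or_lt with rfl | hlt
    · simp [upperRatio]
    have hjr : (0 : ℝ) < n - j := by
      have : (j : ℝ) < n := by exact_mod_cast hlt
      linarith
    have hwj := weight_pos h0 h1 hj
    have e : weight n p j * upperRatio n p (j + 1) =
        (∑ i ∈ Finset.Ico (j + 1) (n + 1), weight n p i) / (p * (n - j)) := by
      unfold upperRatio; rw [flow_succ]; field_simp
    rw [e, div_le_div_iff₀ (by positivity) hcpos, Finset.sum_mul, Finset.sum_mul]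
    refine Finset.sum_le_sum fun i hi => ?_
    rw [Finset.mem_Ico] at hi
    have hij : (n : ℝ) + 1 - i ≤ n - j := by
      have : (j : ℝ) + 1 ≤ i := by exact_mod_cast hi.1
      linarith
    have := weight_eq_weight_succ n p (k := i) (by omega)
    calc weight n p i * c = p * ((n + 1) * (1 - p) * weight n p i) := by rw [hc]; ring
      _ = p * ((n + 1 - i) * weight (n + 1) p i) := by rw [this]
      _ ≤ p * ((n - j) * weight (n + 1) p i) := by
        have := hw' i
        gcongr
      _ = _ := by ring
  have hsum : (∑ i ∈ Finset.range j, weight (n + 1) p (i + 1)) +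
      ∑ i ∈ Finset.Ico (j + 1) (n + 1), weight (n + 1) p i ≤ 1 := by
    rw [← sum_weight (n + 1) p, Finset.range_eq_Ico, Finset.sum_Ico_add' _ 0 j 1,
      Finset.sum_Ico_consecutive _ (by omega) (by omega)]
    refine Finset.sum_le_sum_of_subset_of_nonneg ?_ fun i _ _ => hw' i
    intro i hi
    simp only [Finset.mem_Ico, Finset.mem_range] at hi ⊢
    omega
  rw [mul_add]
  calc _ ≤ _ := add_le_add hU hL
    _ = ((∑ i ∈ Finset.range j, weight (n + 1) p (i + 1)) +
      ∑ i ∈ Finset.Ico (j + 1) (n + 1), weight (n + 1) p i) / c := by ring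
    _ ≤ 1 / c := by gcongr

/-! ### Solving the Stein equation for points and finite sets -/

/-- Solution of the Stein equation for the indicator of `{j}`. -/
def pointSol (n : ℕ) (p : ℝ) (j k : ℕ) : ℝ :=
  weight n p j * if k ≤ j then lowerRatio n p k else -upperRatio n p k

theorem pointSol_zero (j : ℕ) : pointSol n p j 0 = 0 := by simp [pointSol, lowerRatio]

theorem pointSol_of_gt {k : ℕ} (hk : n < k) (j : ℕ) : pointSol n p j k = 0 := by
  simp [pointSol, lowerRatio, upperRatio, weight_eq_zero hk]

theorem mul_lowerRatio (h0 : 0 < p) (h1 : p < 1) {k : ℕ} (hkn : k ≤ n) :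
    (1 - p) * k * weight n p k * lowerRatio n p k = ∑ i ∈ Finset.range k, weight n p i := by
  rcases Nat.eq_zero_or_pos k with rfl | hk
  · simp
  · have := (flow_pos h0 h1 hk hkn).ne'
    unfold lowerRatio; rw [mul_div_cancel₀ _ this]

theorem mul_upperRatio (h0 : 0 < p) (h1 : p < 1) {k : ℕ} (hk : 1 ≤ k) (hkn : k ≤ n + 1) :
    (1 - p) * k * weight n p k * upperRatio n p k =
      ∑ i ∈ Finset.Ico k (n + 1), weight n p i := by
  rcases hkn.eq_or_lt with rfl | h
  · simp [weight_eq_zero]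
  · have := (flow_pos h0 h1 hk (by omega : k ≤ n)).ne'
    unfold upperRatio; rw [mul_div_cancel₀ _ this]

theorem pointSol_eq (h0 : 0 < p) (h1 : p < 1) {j k : ℕ} (hj : j ≤ n) (hk : k ≤ n) :
    (1 - p) * k * pointSol n p j k - p * (n - k) * pointSol n p j (k + 1) =
      (if k = j then 1 else 0) - weight n p j := by
  have hw := weight_pos h0 h1 hk
  -- After multiplication by the weight at `k`, detailed balance turns the birth term into the death
  -- flow at `k + 1`, and the equation telescopes over the tails.
  refine mul_left_cancel₀ hw.ne' ?_
  have key : weight n p k * ((1 - p) * k * pointSol n p j k -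
      p * (n - k) * pointSol n p j (k + 1)) =
      (1 - p) * k * weight n p k * pointSol n p j k -
        (1 - p) * ((k + 1 : ℕ) : ℝ) * weight n p (k + 1) * pointSol n p j (k + 1) := by
    rw [flow_succ]; ring
  rw [key]
  have hU := mul_upperRatio h0 h1 (n := n) (k := k + 1) (by omega) (by omega)
  have htot := sum_weight n p
  rw [Finset.range_eq_Ico, ← Finset.sum_Ico_consecutive _ (Nat.zero_le k) (by omega : k ≤ n + 1),
    Finset.sum_eq_sum_Ico_succ_bot (by omega : k < n + 1), ← Finset.range_eq_Ico] at htot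
  have hL := mul_lowerRatio h0 h1 hk
  unfold pointSol
  rcases lt_trichotomy k j with h | rfl | h
  · have hL' := mul_lowerRatio h0 h1 (n := n) (k := k + 1) (by omega)
    rw [Finset.sum_range_succ] at hL'
    rw [if_pos h.le, if_pos (Nat.succ_le_of_lt h), if_neg h.ne]
    linear_combination weight n p j * hL - weight n p j * hL'
  · rw [if_pos le_rfl, if_neg (by omega), if_pos rfl]
    linear_combination weight n p k * hL + weight n p k * hU + weight n p k * htot
  · have hU' := mul_upperRatio h0 h1 (n := n) (k := k) (by omega) (by omega)
    rw [Finset.sum_eq_sum_Ico_succ_bot (by omega : k < n + 1)] at hU'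
    rw [if_neg (by omega), if_neg (by omega), if_neg (by omega)]
    linear_combination weight n p j * hU - weight n p j * hU'

theorem sum_pointSol (k : ℕ) :
    ∑ j ∈ Finset.range (n + 1), pointSol n p j k = 0 := by
  rcases Nat.lt_or_ge n k with hk | hk
  · exact Finset.sum_eq_zero fun j _ => pointSol_of_gt hk j
  rw [Finset.range_eq_Ico, ← Finset.sum_Ico_consecutive _ (Nat.zero_le k) (by omega : k ≤ n + 1)]
  have e1 : ∑ j ∈ Finset.Ico 0 k, pointSol n p j k =
      (∑ j ∈ Finset.range k, weight n p j) * -upperRatio n p k := by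
    rw [Finset.sum_mul, Finset.range_eq_Ico]
    refine Finset.sum_congr rfl fun j hj => ?_
    rw [pointSol, if_neg (by simp at hj; omega)]
  have e2 : ∑ j ∈ Finset.Ico k (n + 1), pointSol n p j k =
      (∑ j ∈ Finset.Ico k (n + 1), weight n p j) * lowerRatio n p k := by
    rw [Finset.sum_mul]
    refine Finset.sum_congr rfl fun j hj => ?_
    rw [pointSol, if_pos (by simp at hj; omega)]
  rw [e1, e2, upperRatio, lowerRatio]
  ring

theorem pointSol_diff_nonneg (h0 : 0 < p) (h1 : p < 1) {j k : ℕ} (hj : j ≤ n) (hk : k ≤ n)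
    (hjk : j ≠ k) : 0 ≤ pointSol n p j (k + 1) - pointSol n p j k := by
  unfold pointSol
  rw [← mul_sub]
  refine mul_nonneg (weight_nonneg h0 h1 j) ?_
  rcases hjk.lt_or_gt with h | h
  · rw [if_neg (by omega), if_neg (by omega)]
    have := upperRatio_succ_le (n := n) h0 h1 (k := k) (by omega) hk
    linarith
  · rw [if_pos (by omega), if_pos (by omega)]
    have := lowerRatio_le_succ (n := n) h0 h1 (k := k) (by omega)
    linarith

theorem pointSol_diff_self (k : ℕ) : pointSol n p k (k + 1) - pointSol n p k k =
    -(weight n p k * (upperRatio n p (k + 1) + lowerRatio n p k)) := by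
  unfold pointSol
  rw [if_neg (by omega), if_pos le_rfl]
  ring

/-- By monotonicity the ratios are largest next to the jump, at `k = j` on the left and at `k = j +
1` on the right, where their sum is already controlled. -/
theorem abs_pointSol_le (h0 : 0 < p) (h1 : p < 1) {j : ℕ} (hj : j ≤ n) (k : ℕ) :
    |pointSol n p j k| ≤ 1 / ((n + 1) * (p * (1 - p))) := by
  have hq : 0 < 1 - p := by linarith
  rcases Nat.lt_or_ge n k with hk | hk
  · rw [pointSol_of_gt hk, abs_zero]; positivity
  refine le_trans ?_ (weight_mul_ratios_le h0 h1 hj)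
  rw [pointSol, abs_mul, abs_of_nonneg (weight_nonneg h0 h1 j)]
  refine mul_le_mul_of_nonneg_left ?_ (weight_nonneg h0 h1 j)
  have hL := lowerRatio_nonneg (n := n) h0 h1
  have hU := upperRatio_nonneg (n := n) h0 h1
  split_ifs with h
  · rw [abs_of_nonneg (hL k)]
    linarith [lowerRatio_mono h0 h1 h hj, hU (j + 1)]
  · rw [abs_neg, abs_of_nonneg (hU k)]
    linarith [upperRatio_anti (n := n) h0 h1 (k := j + 1) (j := k) (by omega) (by omega) (by omega),
      hL j]

/-- Superpose the point solutions. For fixed `k` only the increment of the solution for `j = k` can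
be negative, and the increments sum to zero over all `j`. Hence every partial sum is bounded in
modulus by that single increment, whatever the size of `A`. -/
theorem exists_solution (h0 : 0 < p) (h1 : p < 1) (A : Finset ℕ)
    (hA : A ⊆ Finset.range (n + 1)) :
    ∃ γ : ℕ → ℝ, γ 0 = 0 ∧ (∀ k, n < k → γ k = 0) ∧
      (∀ k ≤ n, (1 - p) * k * γ k - p * (n - k) * γ (k + 1) =
        (if k ∈ A then 1 else 0) - ∑ j ∈ A, weight n p j) ∧
      (∀ k, |γ (k + 1) - γ k| ≤ 1 / ((n + 1) * (p * (1 - p)))) ∧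
      (A.card ≤ 1 → ∀ k, |γ k| ≤ 1 / ((n + 1) * (p * (1 - p)))) := by
  have hq : 0 < 1 - p := by linarith
  have hAn : ∀ j ∈ A, j ≤ n := fun j hj => by have := Finset.mem_range.1 (hA hj); omega
  refine ⟨fun k => ∑ j ∈ A, pointSol n p j k, ?_, ?_, ?_, ?_, ?_⟩
  · exact Finset.sum_eq_zero fun j _ => pointSol_zero j
  · exact fun k hk => Finset.sum_eq_zero fun j _ => pointSol_of_gt hk j
  · intro k hk
    rw [Finset.mul_sum, Finset.mul_sum, ← Finset.sum_sub_distrib,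
      Finset.sum_congr rfl fun j hj => pointSol_eq h0 h1 (hAn j hj) hk, Finset.sum_sub_distrib,
      Finset.sum_ite_eq]
  · intro k
    rcases Nat.lt_or_ge n k with hk | hk
    · simp only [pointSol_of_gt hk, pointSol_of_gt (hk.trans (Nat.lt_succ_self k))]
      simp only [Finset.sum_const_zero, sub_zero, abs_zero]
      positivity
    rw [← Finset.sum_sub_distrib]
    set d : ℕ → ℝ := fun j => pointSol n p j (k + 1) - pointSol n p j k with hd
    have hdk : -(1 / ((n + 1) * (p * (1 - p)))) ≤ d k ∧ d k ≤ 0 := by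
      rw [hd]
      simp only [pointSol_diff_self]
      refine ⟨neg_le_neg (weight_mul_ratios_le h0 h1 hk), neg_nonpos.2 ?_⟩
      exact mul_nonneg (weight_nonneg h0 h1 k)
        (add_nonneg (upperRatio_nonneg h0 h1 _) (lowerRatio_nonneg h0 h1 _))
    have hpos : ∀ j ∈ (Finset.range (n + 1)).erase k, 0 ≤ d j := by
      intro j hj
      rw [Finset.mem_erase, Finset.mem_range] at hj
      exact pointSol_diff_nonneg h0 h1 (by omega) hk hj.1
    have hsum : d k + ∑ j ∈ (Finset.range (n + 1)).erase k, d j = 0 := by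
      rw [Finset.add_sum_erase _ _ (Finset.mem_range.2 (by omega)), hd, Finset.sum_sub_distrib,
        sum_pointSol, sum_pointSol, sub_zero]
    have hAe : A.erase k ⊆ (Finset.range (n + 1)).erase k := Finset.erase_subset_erase k hA
    have hle : ∑ j ∈ A.erase k, d j ≤ ∑ j ∈ (Finset.range (n + 1)).erase k, d j :=
      Finset.sum_le_sum_of_subset_of_nonneg hAe fun j hj _ => hpos j hj
    have hge : 0 ≤ ∑ j ∈ A.erase k, d j := Finset.sum_nonneg fun j hj => hpos j (hAe hj)
    rw [abs_le]
    by_cases hkA : k ∈ A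
    · rw [← Finset.add_sum_erase A d hkA]
      constructor <;> linarith [hdk.1, hdk.2]
    · rw [Finset.erase_eq_of_notMem hkA] at hle hge
      constructor <;> linarith [hdk.1, hdk.2]
  · intro hcard k
    rcases Finset.card_le_one_iff_subset_singleton.1 hcard with ⟨j, hj⟩
    rcases Finset.subset_singleton_iff.1 hj with rfl | rfl
    · simp only [Finset.sum_empty, abs_zero]; positivity
    · simpa using abs_pointSol_le h0 h1 (hAn j (by simp)) k

end BinomialStein

/-! ### Total variation and smoothness -/

/-- Integrals of a bounded function against two finite measures differ by at most the sup norm of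
the function times the total variation of the difference of the measures. -/
theorem abs_integral_sub_integral_le {ρ₁ ρ₂ : Measure ℝ} [IsFiniteMeasure ρ₁] [IsFiniteMeasure ρ₂]
    {s : SignedMeasure ℝ} (hs : ∀ A, MeasurableSet A → s A = ρ₁.real A - ρ₂.real A)
    {φ : ℝ → ℝ} (hφ : Measurable φ) {C : ℝ} (hC : ∀ x, |φ x| ≤ C) :
    |∫ x, φ x ∂ρ₁ - ∫ x, φ x ∂ρ₂| ≤ C * (s.totalVariation univ).toReal := by
  set j := s.toJordanDecomposition with hj
  have hint : ∀ (ρ : Measure ℝ) [IsFiniteMeasure ρ], Integrable φ ρ := fun ρ _ =>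
    Integrable.of_bound hφ.aestronglyMeasurable C (.of_forall fun x => hC x)
  have hle : ∀ (ρ : Measure ℝ) [IsFiniteMeasure ρ], |∫ x, φ x ∂ρ| ≤ C * ρ.real univ :=
    fun ρ _ => by
      rw [← Real.norm_eq_abs]
      exact norm_integral_le_of_norm_le_const (.of_forall fun x => hC x)
  -- Rearranging `ρ₁ - ρ₂ = j⁺ - j⁻` into an identity of positive measures allows integration of
  -- both sides.
  have hadd : ρ₁ + j.negPart = ρ₂ + j.posPart := by
    ext A hA
    rw [← measureReal_eq_measureReal_iff, measureReal_add_apply, measureReal_add_apply]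
    have h1 := hs A hA
    rw [s.apply_eq_posPart_real_sub_negPart_real hA] at h1
    linarith
  have h2 := congrArg (fun ρ => ∫ x, φ x ∂ρ) hadd
  simp only [integral_add_measure (hint _) (hint _)] at h2
  have htv : (s.totalVariation univ).toReal = j.posPart.real univ + j.negPart.real univ := by
    rw [SignedMeasure.totalVariation, ← measureReal_def, measureReal_add_apply]
  rw [htv, show ∫ x, φ x ∂ρ₁ - ∫ x, φ x ∂ρ₂ = ∫ x, φ x ∂j.posPart - ∫ x, φ x ∂j.negPart by
    linarith, mul_add]
  exact (abs_sub _ _).trans (add_le_add (hle _) (hle _))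

theorem convDiff_apply (s : SignedMeasure ℝ) {A : Set ℝ} (hA : MeasurableSet A) :
    convDiff s A = s ((fun x : ℝ => x + 1) ⁻¹' A) - s A := by
  rw [convDiff, _root_.sub_apply, VectorMeasure.map_apply _ (by fun_prop) hA]

theorem abs_integral_diff_le_smoothD_one (ν : Measure ℝ) [IsFiniteMeasure ν] {φ : ℝ → ℝ}
    (hφ : Measurable φ) {C : ℝ} (hC : ∀ x, |φ x| ≤ C) :
    |∫ x, (φ (x + 1) - φ x) ∂ν| ≤ C * (smoothD 1 ν).toReal := by
  have hsh : Measurable fun x : ℝ => x + 1 := by fun_prop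
  have hint : ∀ (f : ℝ → ℝ), Measurable f → Integrable (fun x => φ (f x)) ν := fun f hf =>
    Integrable.of_bound (hφ.comp hf).aestronglyMeasurable C (.of_forall fun x => hC _)
  have hint' : Integrable φ ν := hint id measurable_id
  rw [integral_sub (hint _ hsh) hint',
    ← integral_map hsh.aemeasurable hφ.aestronglyMeasurable]
  refine abs_integral_sub_integral_le (fun A hA => ?_) hφ hC
  rw [Function.iterate_one, convDiff_apply _ hA,
    Measure.toSignedMeasure_apply_measurable (hsh hA), Measure.toSignedMeasure_apply_measurable hA,
    map_measureReal_apply hsh hA]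

theorem abs_integral_diff_le_smoothD_two (ν : Measure ℝ) [IsFiniteMeasure ν] {φ : ℝ → ℝ}
    (hφ : Measurable φ) {C : ℝ} (hC : ∀ x, |φ x| ≤ C) :
    |∫ x, (φ (x + 2) - 2 * φ (x + 1) + φ x) ∂ν| ≤ C * (smoothD 2 ν).toReal := by
  have hsh : Measurable fun x : ℝ => x + 1 := by fun_prop
  have hsh2 : Measurable fun x : ℝ => x + 2 := by fun_prop
  have hint : ∀ (ρ : Measure ℝ) [IsFiniteMeasure ρ] (f : ℝ → ℝ), Measurable f →
      Integrable (fun x => φ (f x)) ρ := fun ρ _ f hf =>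
    Integrable.of_bound (hφ.comp hf).aestronglyMeasurable C (.of_forall fun x => hC _)
  have hint' : ∀ (ρ : Measure ℝ) [IsFiniteMeasure ρ], Integrable φ ρ := fun ρ _ =>
    hint ρ id measurable_id
  have e : ∫ x, (φ (x + 2) - 2 * φ (x + 1) + φ x) ∂ν =
      ∫ x, φ x ∂(ν.map (fun x => x + 2) + ν) -
        ∫ x, φ x ∂(ν.map (fun x => x + 1) + ν.map (fun x => x + 1)) := by
    rw [integral_add_measure (hint' _) (hint' _), integral_add_measure (hint' _) (hint' _),
      integral_map hsh.aemeasurable hφ.aestronglyMeasurable,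
      integral_map hsh2.aemeasurable hφ.aestronglyMeasurable,
      integral_add (f := fun x => φ (x + 2) - 2 * φ (x + 1))
        ((hint _ _ hsh2).sub ((hint _ _ hsh).const_mul 2)) (hint' _),
      integral_sub (hint _ _ hsh2) ((hint _ _ hsh).const_mul 2), integral_const_mul]
    ring
  rw [e]
  refine abs_integral_sub_integral_le (fun A hA => ?_) hφ hC
  have hpre : (fun x : ℝ => x + 1) ⁻¹' ((fun x : ℝ => x + 1) ⁻¹' A) = (fun x : ℝ => x + 2) ⁻¹' A := by
    ext x
    simp only [mem_preimage]
    rw [add_assoc, one_add_one_eq_two]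
  rw [Function.iterate_succ_apply, Function.iterate_one, convDiff_apply _ hA,
    convDiff_apply _ (hsh hA), convDiff_apply _ hA, hpre,
    Measure.toSignedMeasure_apply_measurable (hsh2 hA),
    Measure.toSignedMeasure_apply_measurable (hsh hA), Measure.toSignedMeasure_apply_measurable hA,
    measureReal_add_apply, measureReal_add_apply, map_measureReal_apply hsh hA,
    map_measureReal_apply hsh2 hA]
  ring

/-! ### Quadratic spline interpolation -/

namespace Spline

/-- Derivative of `max x 0` off the origin. -/
def step (x : ℝ) : ℝ := if 0 ≤ x then 1 else 0

/-- The quadratic B-spline with knots `-2, -1, 0, 1`. -/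
def bump (x : ℝ) : ℝ :=
  (max (x + 2) 0 ^ 2 - 3 * max (x + 1) 0 ^ 2 + 3 * max x 0 ^ 2 - max (x - 1) 0 ^ 2) / 2

/-- First derivative of `bump`. -/
def bump₁ (x : ℝ) : ℝ := max (x + 2) 0 - 3 * max (x + 1) 0 + 3 * max x 0 - max (x - 1) 0

/-- Second derivative of `bump` off the integers. -/
def bump₂ (x : ℝ) : ℝ := step (x + 2) - 3 * step (x + 1) + 3 * step x - step (x - 1)

theorem hasDerivAt_max_zero {x : ℝ} (hx : x ≠ 0) : HasDerivAt (fun y : ℝ => max y 0) (step x) x := by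
  rcases hx.lt_or_gt with h | h
  · rw [step, if_neg (not_le.2 h)]
    refine (hasDerivAt_const x (0 : ℝ)).congr_of_eventuallyEq ?_
    filter_upwards [Iio_mem_nhds h] with y hy using max_eq_right (le_of_lt hy)
  · rw [step, if_pos h.le]
    refine (hasDerivAt_id x).congr_of_eventuallyEq ?_
    filter_upwards [Ioi_mem_nhds h] with y hy using max_eq_left (le_of_lt hy)

theorem hasDerivAt_max_zero_sq (x : ℝ) :
    HasDerivAt (fun y : ℝ => max y 0 ^ 2) (2 * max x 0) x := by
  rcases eq_or_ne x 0 with rfl | hx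
  · rw [max_self, mul_zero, hasDerivAt_iff_isLittleO_nhds_zero]
    simp only [zero_add, max_self, ne_eq, OfNat.ofNat_ne_zero, not_false_eq_true, zero_pow,
      sub_zero, smul_zero]
    refine Asymptotics.IsBigO.trans_isLittleO (g := fun h : ℝ => h ^ 2) ?_ ?_
    · refine Asymptotics.IsBigO.of_bound 1 (.of_forall fun h => ?_)
      rw [one_mul, norm_pow, norm_pow]
      gcongr
      rcases le_total h 0 with h0 | h0 <;> simp [h0]
    · exact Asymptotics.isLittleO_pow_id one_lt_two
  · have := (hasDerivAt_max_zero hx).pow 2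
    refine this.congr_deriv ?_
    rcases hx.lt_or_gt with h | h
    · simp [step, not_le.2 h, h.le]
    · simp [step, h.le]

theorem hasDerivAt_bump (x : ℝ) : HasDerivAt bump (bump₁ x) x := by
  have h : ∀ c : ℝ, HasDerivAt (fun y : ℝ => max (y + c) 0 ^ 2) (2 * max (x + c) 0) x := fun c =>
    (hasDerivAt_max_zero_sq (x + c)).comp_add_const x c
  have := ((((h 2).sub ((h 1).const_mul 3)).add ((h 0).const_mul 3)).sub (h (-1))).div_const 2
  have e : bump = fun y : ℝ => (max (y + 2) 0 ^ 2 - 3 * max (y + 1) 0 ^ 2 +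
      3 * max (y + 0) 0 ^ 2 - max (y + -1) 0 ^ 2) / 2 := by
    ext y; simp only [bump, add_zero, sub_eq_add_neg]
  rw [e]
  refine this.congr_deriv ?_
  simp only [bump₁, add_zero, sub_eq_add_neg]; ring

theorem hasDerivAt_bump₁ {x : ℝ} (hx : x ∉ range ((↑) : ℤ → ℝ)) :
    HasDerivAt bump₁ (bump₂ x) x := by
  have h : ∀ c : ℤ, HasDerivAt (fun y : ℝ => max (y + c) 0) (step (x + c)) x := fun c =>
    (hasDerivAt_max_zero (fun h0 => hx ⟨-c, by push_cast; linarith⟩)).comp_add_const x c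
  have := (((h 2).sub ((h 1).const_mul 3)).add ((h 0).const_mul 3)).sub (h (-1))
  have e : bump₁ = fun y : ℝ => max (y + (2 : ℤ)) 0 - 3 * max (y + (1 : ℤ)) 0 +
      3 * max (y + (0 : ℤ)) 0 - max (y + (-1 : ℤ)) 0 := by
    ext y; simp [bump₁, sub_eq_add_neg]
  rw [e]
  refine this.congr_deriv ?_
  simp [bump₂, sub_eq_add_neg]

theorem continuous_bump₁ : Continuous bump₁ := by unfold bump₁; fun_prop

theorem continuous_bump : Continuous bump := by unfold bump; fun_prop

theorem bump_of_le {x : ℝ} (h : x ≤ -2) : bump x = 0 := by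
  rw [bump, max_eq_right (by linarith), max_eq_right (by linarith), max_eq_right (by linarith),
    max_eq_right (by linarith)]; ring

theorem bump_of_ge {x : ℝ} (h : 1 ≤ x) : bump x = 0 := by
  rw [bump, max_eq_left (by linarith), max_eq_left (by linarith), max_eq_left (by linarith),
    max_eq_left (by linarith)]; ring

theorem bump₁_of_le {x : ℝ} (h : x ≤ -2) : bump₁ x = 0 := by
  rw [bump₁, max_eq_right (by linarith), max_eq_right (by linarith), max_eq_right (by linarith),
    max_eq_right (by linarith)]; ring

theorem bump₁_of_ge {x : ℝ} (h : 1 ≤ x) : bump₁ x = 0 := by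
  rw [bump₁, max_eq_left (by linarith), max_eq_left (by linarith), max_eq_left (by linarith),
    max_eq_left (by linarith)]; ring

theorem bump_int (m : ℤ) :
    bump m = ((if m = 0 then 1 else 0) + if m = -1 then 1 else 0) / 2 := by
  rcases le_or_gt m (-2) with h | h
  · rw [bump_of_le (by exact_mod_cast h), if_neg (by omega), if_neg (by omega)]; simp
  rcases le_or_gt 1 m with h' | h'
  · rw [bump_of_ge (by exact_mod_cast h'), if_neg (by omega), if_neg (by omega)]; simp
  obtain rfl | rfl : m = 0 ∨ m = -1 := by omega
  all_goals norm_num [bump]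

theorem bump₁_int (m : ℤ) :
    bump₁ m = (if m = -1 then 1 else 0) - if m = 0 then 1 else 0 := by
  rcases le_or_gt m (-2) with h | h
  · rw [bump₁_of_le (by exact_mod_cast h), if_neg (by omega), if_neg (by omega)]; simp
  rcases le_or_gt 1 m with h' | h'
  · rw [bump₁_of_ge (by exact_mod_cast h'), if_neg (by omega), if_neg (by omega)]; simp
  obtain rfl | rfl : m = 0 ∨ m = -1 := by omega
  all_goals norm_num [bump₁]

theorem exists_bound {f : ℝ → ℝ} (hf : Continuous f) (h1 : ∀ x ≤ -2, f x = 0)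
    (h2 : ∀ x, 1 ≤ x → f x = 0) : ∃ C, ∀ x, |f x| ≤ C := by
  obtain ⟨C, hC⟩ := (isCompact_Icc (a := (-2 : ℝ)) (b := 1)).exists_bound_of_continuousOn
    hf.continuousOn
  refine ⟨max C 0, fun x => ?_⟩
  rcases le_or_gt x (-2) with h | h
  · rw [h1 x h, abs_zero]; exact le_max_right _ _
  rcases le_or_gt 1 x with h' | h'
  · rw [h2 x h', abs_zero]; exact le_max_right _ _
  exact (hC x ⟨h.le, h'.le⟩).trans (le_max_left _ _)

variable (n : ℕ) (γ : ℕ → ℝ)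

/-- Spline with coefficients `γ 0, …, γ n`. -/
def interp (x : ℝ) : ℝ := ∑ i ∈ Finset.range (n + 1), γ i * bump (x - i)

/-- First derivative of `interp`. -/
def interp₁ (x : ℝ) : ℝ := ∑ i ∈ Finset.range (n + 1), γ i * bump₁ (x - i)

/-- The step function with value `γ k` on `[k, k + 1)`. -/
def stepFun (x : ℝ) : ℝ := γ ⌊x⌋₊

/-- Second derivative of `interp` off the integers. -/
def interp₂ (x : ℝ) : ℝ := stepFun γ (x + 2) - 2 * stepFun γ (x + 1) + stepFun γ x

variable {n γ}

theorem measurable_stepFun : Measurable (stepFun γ) :=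
  (measurable_from_top (f := γ)).comp Nat.measurable_floor

theorem measurable_interp₂ : Measurable (interp₂ γ) := by
  have := measurable_stepFun (γ := γ)
  unfold interp₂; fun_prop

theorem continuous_interp : Continuous (interp n γ) := by
  have := continuous_bump
  unfold interp; fun_prop

theorem continuous_interp₁ : Continuous (interp₁ n γ) := by
  have := continuous_bump₁
  unfold interp₁; fun_prop

theorem exists_bound_sum {f : ℝ → ℝ} (hf : ∃ C, ∀ x, |f x| ≤ C) :
    ∃ C, ∀ x : ℝ, |∑ i ∈ Finset.range (n + 1), γ i * f (x - i)| ≤ C := by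
  obtain ⟨C, hC⟩ := hf
  refine ⟨∑ i ∈ Finset.range (n + 1), |γ i| * C, fun x => ?_⟩
  refine (Finset.abs_sum_le_sum_abs _ _).trans (Finset.sum_le_sum fun i _ => ?_)
  rw [abs_mul]
  exact mul_le_mul_of_nonneg_left (hC _) (abs_nonneg _)

theorem exists_bound_interp : ∃ C, ∀ x, |interp n γ x| ≤ C :=
  exists_bound_sum (exists_bound continuous_bump (fun _ => bump_of_le) fun _ => bump_of_ge)

theorem exists_bound_interp₁ : ∃ C, ∀ x, |interp₁ n γ x| ≤ C :=
  exists_bound_sum (exists_bound continuous_bump₁ (fun _ => bump₁_of_le) fun _ => bump₁_of_ge)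

theorem hasDerivAt_interp (x : ℝ) : HasDerivAt (interp n γ) (interp₁ n γ x) x := by
  unfold interp interp₁
  exact HasDerivAt.fun_sum fun i _ => ((hasDerivAt_bump (x - i)).comp_sub_const x i).const_mul _

theorem stepFun_eq_sum (hγ0 : γ 0 = 0) (hγ : ∀ k, n < k → γ k = 0) (x : ℝ) :
    stepFun γ x = ∑ i ∈ Finset.range (n + 1), γ i * (step (x - i) - step (x - i - 1)) := by
  have hi : ∀ i : ℕ, γ i * (step (x - i) - step (x - i - 1)) = if i = ⌊x⌋₊ then γ i else 0 := by
    intro i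
    -- Index `0` stands apart because `⌊x⌋₊ = 0` on the whole negative axis; `γ 0 = 0` makes this
    -- harmless.
    rcases Nat.eq_zero_or_pos i with rfl | hi
    · simp [hγ0]
    by_cases h : i = ⌊x⌋₊
    · have h' := (Nat.floor_eq_iff' hi.ne').1 h.symm
      rw [if_pos h, step, step, if_pos (by linarith), if_neg (by linarith)]; ring
    · rw [if_neg h]
      have h' := mt (fun h' => ((Nat.floor_eq_iff' hi.ne').2 h').symm) h
      rw [not_and_or, not_le, not_lt] at h'
      unfold step
      rcases h' with h' | h'
      · rw [if_neg (by linarith), if_neg (by linarith)]; ring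
      · rw [if_pos (by linarith), if_pos (by linarith)]; ring
  rw [Finset.sum_congr rfl fun i _ => hi i, Finset.sum_ite_eq', stepFun]
  split_ifs with h
  · rfl
  · rw [Finset.mem_range] at h
    exact hγ _ (by omega)

theorem interp₂_eq_sum (hγ0 : γ 0 = 0) (hγ : ∀ k, n < k → γ k = 0) (x : ℝ) :
    interp₂ γ x = ∑ i ∈ Finset.range (n + 1), γ i * bump₂ (x - i) := by
  simp only [interp₂, stepFun_eq_sum hγ0 hγ]
  rw [Finset.mul_sum, ← Finset.sum_sub_distrib, ← Finset.sum_add_distrib]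
  refine Finset.sum_congr rfl fun i _ => ?_
  rw [bump₂, show x + 2 - i = x - i + 2 by ring, show x + 1 - i = x - i + 1 by ring,
    show x - i + 2 - 1 = x - i + 1 by ring, show x - i + 1 - 1 = x - (i : ℝ) by ring]
  ring

theorem hasDerivAt_interp₁ (hγ0 : γ 0 = 0) (hγ : ∀ k, n < k → γ k = 0) {x : ℝ}
    (hx : x ∉ range ((↑) : ℤ → ℝ)) : HasDerivAt (interp₁ n γ) (interp₂ γ x) x := by
  rw [interp₂_eq_sum hγ0 hγ]
  unfold interp₁
  refine HasDerivAt.fun_sum fun i _ => HasDerivAt.const_mul _ ?_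
  refine (hasDerivAt_bump₁ (x := x - i) ?_).comp_sub_const x i
  rintro ⟨m, hm⟩
  exact hx ⟨m + i, by push_cast; linarith⟩

theorem interp_nat (hγ : ∀ k, n < k → γ k = 0) (k : ℕ) :
    interp n γ k = (γ k + γ (k + 1)) / 2 := by
  have hs : ∀ m : ℕ, ∑ i ∈ Finset.range (n + 1), (if i = m then γ i else 0) = γ m := by
    intro m
    rw [Finset.sum_ite_eq']
    split_ifs with h
    · rfl
    · rw [Finset.mem_range] at h
      exact (hγ _ (by omega)).symm
  rw [← hs k, ← hs (k + 1), ← Finset.sum_add_distrib, Finset.sum_div]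
  refine Finset.sum_congr rfl fun i _ => ?_
  have := bump_int ((k : ℤ) - i)
  push_cast at this
  rw [this]
  simp only [show ((k : ℤ) - i = 0) = (i = k) by apply propext; omega,
    show ((k : ℤ) - i = -1) = (i = k + 1) by apply propext; omega]
  split_ifs <;> ring

theorem interp₁_nat (hγ : ∀ k, n < k → γ k = 0) (k : ℕ) :
    interp₁ n γ k = γ (k + 1) - γ k := by
  have hs : ∀ m : ℕ, ∑ i ∈ Finset.range (n + 1), (if i = m then γ i else 0) = γ m := by
    intro m
    rw [Finset.sum_ite_eq']
    split_ifs with h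
    · rfl
    · rw [Finset.mem_range] at h
      exact (hγ _ (by omega)).symm
  rw [← hs k, ← hs (k + 1), ← Finset.sum_sub_distrib]
  refine Finset.sum_congr rfl fun i _ => ?_
  have := bump₁_int ((k : ℤ) - i)
  push_cast at this
  rw [this]
  simp only [show ((k : ℤ) - i = 0) = (i = k) by apply propext; omega,
    show ((k : ℤ) - i = -1) = (i = k + 1) by apply propext; omega]
  split_ifs <;> ring

theorem interp_of_le (hγ0 : γ 0 = 0) {x : ℝ} (hx : x ≤ -1) : interp n γ x = 0 := by
  refine Finset.sum_eq_zero fun i _ => ?_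
  rcases Nat.eq_zero_or_pos i with rfl | hi
  · rw [hγ0, zero_mul]
  · have : (1 : ℝ) ≤ i := by exact_mod_cast hi
    rw [bump_of_le (by linarith), mul_zero]

theorem interp₁_of_le (hγ0 : γ 0 = 0) {x : ℝ} (hx : x ≤ -1) : interp₁ n γ x = 0 := by
  refine Finset.sum_eq_zero fun i _ => ?_
  rcases Nat.eq_zero_or_pos i with rfl | hi
  · rw [hγ0, zero_mul]
  · have : (1 : ℝ) ≤ i := by exact_mod_cast hi
    rw [bump₁_of_le (by linarith), mul_zero]

/-! ### Taylor expansion of the spline -/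

/-- The spline's derivative is only piecewise linear, so the fundamental theorem of calculus is used
off the countable set of `s` where `x + s h` is an integer. -/
theorem interp₁_add_sub (hγ0 : γ 0 = 0) (hγ : ∀ k, n < k → γ k = 0) {C : ℝ}
    (hC : ∀ x, |interp₂ γ x| ≤ C) (x h : ℝ) :
    interp₁ n γ (x + h) - interp₁ n γ x = ∫ s in (0 : ℝ)..1, h * interp₂ γ (x + s * h) := by
  rcases eq_or_ne h 0 with rfl | hh
  · simp
  have hcont := continuous_interp₁ (n := n) (γ := γ)
  rw [integral_eq_of_hasDerivAt_off_countable (fun s => interp₁ n γ (x + s * h)) _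
    (s := (fun m : ℤ => ((m : ℝ) - x) / h) '' univ) (countable_univ.image _)
    (by fun_prop)]
  · simp
  · rintro s ⟨-, hs⟩
    have hsx : x + s * h ∉ range ((↑) : ℤ → ℝ) := by
      rintro ⟨m, hm⟩
      exact hs ⟨m, trivial, by simp only [hm]; field_simp; ring⟩
    have h1 : HasDerivAt (fun s : ℝ => x + s * h) h s := by
      simpa using ((hasDerivAt_id s).mul_const h).const_add x
    rw [mul_comm h]
    exact (hasDerivAt_interp₁ hγ0 hγ hsx).comp s h1
  · have hm := measurable_interp₂ (γ := γ)
    refine intervalIntegrable_const (c := |h| * C) |>.mono_fun ?_ (.of_forall fun s => ?_)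
    · exact Measurable.aestronglyMeasurable (by fun_prop)
    · simp only [Real.norm_eq_abs, abs_mul h]
      exact (mul_le_mul_of_nonneg_left (hC _) (abs_nonneg h)).trans (le_abs_self _)

theorem interp_add_sub (hγ0 : γ 0 = 0) (hγ : ∀ k, n < k → γ k = 0) {C : ℝ}
    (hC : ∀ x, |interp₂ γ x| ≤ C) (x h : ℝ) :
    interp n γ (x + h) - interp n γ x - h * interp₁ n γ x =
      ∫ s in (0 : ℝ)..1, (1 - s) * h ^ 2 * interp₂ γ (x + s * h) := by
  rcases eq_or_ne h 0 with rfl | hh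
  · simp
  have hcont := continuous_interp (n := n) (γ := γ)
  have hcont₁ := continuous_interp₁ (n := n) (γ := γ)
  -- In the derivative of this primitive the two first-order terms cancel, leaving exactly the
  -- Taylor remainder integrand.
  rw [integral_eq_of_hasDerivAt_off_countable
    (fun s => interp n γ (x + s * h) + (1 - s) * h * interp₁ n γ (x + s * h)) _
    (s := (fun m : ℤ => ((m : ℝ) - x) / h) '' univ) (countable_univ.image _)
    (by fun_prop)]
  · simp only [one_mul, sub_self, zero_mul, add_zero, sub_zero]; ring
  · rintro s ⟨-, hs⟩
    have hsx : x + s * h ∉ range ((↑) : ℤ → ℝ) := by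
      rintro ⟨m, hm⟩
      exact hs ⟨m, trivial, by simp only [hm]; field_simp; ring⟩
    have h1 : HasDerivAt (fun s : ℝ => x + s * h) h s := by
      simpa using ((hasDerivAt_id s).mul_const h).const_add x
    have h2 : HasDerivAt (fun s : ℝ => (1 - s) * h) (-1 * h) s :=
      ((hasDerivAt_id s).const_sub 1).mul_const h
    have h3 := ((hasDerivAt_interp (n := n) (γ := γ) (x + s * h)).comp s h1).add
      (h2.mul ((hasDerivAt_interp₁ hγ0 hγ hsx).comp s h1))
    refine h3.congr_deriv ?_
    simp only [Function.comp_apply]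
    ring
  · have hm := measurable_interp₂ (γ := γ)
    have hC0 : 0 ≤ C := (abs_nonneg _).trans (hC 0)
    refine intervalIntegrable_const (c := h ^ 2 * C) |>.mono_fun ?_ ?_
    · exact Measurable.aestronglyMeasurable (by fun_prop)
    · refine (ae_restrict_iff' measurableSet_uIoc).2 (.of_forall fun s hs => ?_)
      rw [uIoc_of_le zero_le_one] at hs
      have hw : 0 ≤ (1 - s) * h ^ 2 := mul_nonneg (by linarith [hs.2]) (sq_nonneg h)
      simp only [Real.norm_eq_abs, abs_mul ((1 - s) * h ^ 2), abs_of_nonneg hw]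
      refine le_trans (mul_le_mul ?_ (hC _) (abs_nonneg _) (sq_nonneg h)) (le_abs_self _)
      nlinarith [hs.1, sq_nonneg h]

/-- Averaging an integral remainder over a measure for which the averages of all translates of the
integrand are bounded. -/
theorem abs_integral_remainder_le {q : ℝ → ℝ} (hq : Measurable q) {C : ℝ} (hC : ∀ x, |q x| ≤ C)
    {w : ℝ → ℝ} (hw : Continuous w) (hw0 : ∀ s ∈ Icc (0 : ℝ) 1, 0 ≤ w s)
    (ν : Measure ℝ) [IsFiniteMeasure ν] {K : ℝ} (hK : ∀ u, |∫ x, q (x + u) ∂ν| ≤ K) (u h : ℝ) :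
    |∫ x, (∫ s in (0 : ℝ)..1, w s * q (x + u + s * h)) ∂ν| ≤
      (∫ s in (0 : ℝ)..1, w s) * K := by
  -- Fubini moves the average over `ν` inside, where the hypothesis bounds it for each `s`
  -- separately; nonnegativity of the weight preserves the bound.
  have hswap : ∫ x, (∫ s in (0 : ℝ)..1, w s * q (x + u + s * h)) ∂ν =
      ∫ s in (0 : ℝ)..1, w s * ∫ x, q (x + (u + s * h)) ∂ν := by
    simp only [intervalIntegral.integral_of_le zero_le_one]
    rw [integral_integral_swap]
    · refine integral_congr_ae (.of_forall fun s => ?_)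
      simp only [integral_const_mul, add_assoc]
    · obtain ⟨D, hD⟩ := (isCompact_Icc (a := (0 : ℝ)) (b := 1)).exists_bound_of_continuousOn
        hw.continuousOn
      refine Integrable.of_bound (C := D * C) (Measurable.aestronglyMeasurable (by fun_prop)) ?_
      have hr : ∀ᵐ z ∂(ν.prod (volume.restrict (Ioc (0 : ℝ) 1))), z.2 ∈ Ioc (0 : ℝ) 1 :=
        Measure.quasiMeasurePreserving_snd.ae (ae_restrict_mem measurableSet_Ioc)
      filter_upwards [hr] with z hz
      have := hD z.2 (Ioc_subset_Icc_self hz)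
      simp only [Function.uncurry, norm_mul]
      exact mul_le_mul this (hC _) (abs_nonneg _) ((norm_nonneg _).trans this)
  rw [hswap, ← intervalIntegral.integral_mul_const, ← Real.norm_eq_abs]
  refine intervalIntegral.norm_integral_le_of_norm_le zero_le_one (.of_forall fun s hs => ?_)
    (Continuous.intervalIntegrable (by fun_prop) _ _)
  have := hw0 s (Ioc_subset_Icc_self hs)
  rw [norm_mul, Real.norm_of_nonneg this]
  exact mul_le_mul_of_nonneg_left (hK _) this

end Spline

/-! ### Test functions controlled by the smoothness of a law -/

/-- Test functions whose first order Taylor remainders, averaged over a law `ν`, are controlled by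
the smoothness `D^l(ν)`. -/
structure IsSmoothTest (l : ℕ) (M : ℝ) (F F₁ : ℝ → ℝ) : Prop where
  measurable : Measurable F
  measurable_deriv : Measurable F₁
  bounded : ∃ C, ∀ x, |F x| ≤ C
  bounded_deriv : ∃ C, ∀ x, |F₁ x| ≤ C
  second_order : ∀ (ν : Measure ℝ) [IsFiniteMeasure ν] (u h : ℝ),
    |∫ x, (F (x + u + h) - F (x + u) - h * F₁ (x + u)) ∂ν| ≤
      M * (h ^ 2 / 2) * (smoothD l ν).toReal
  first_order : ∀ (ν : Measure ℝ) [IsFiniteMeasure ν] (u h : ℝ),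
    |∫ x, (F₁ (x + u + h) - F₁ (x + u)) ∂ν| ≤ M * |h| * (smoothD l ν).toReal

theorem IsSmoothTest.shift {l : ℕ} {M : ℝ} {F F₁ : ℝ → ℝ} (hF : IsSmoothTest l M F F₁) (c : ℝ) :
    IsSmoothTest l M (fun x => F (x + c)) (fun x => F₁ (x + c)) where
  measurable := hF.measurable.comp (by fun_prop)
  measurable_deriv := hF.measurable_deriv.comp (by fun_prop)
  bounded := hF.bounded.imp fun _ h x => h _
  bounded_deriv := hF.bounded_deriv.imp fun _ h x => h _
  second_order ν _ u h := by
    simpa only [add_assoc, add_comm c, add_left_comm c] using hF.second_order ν (u + c) h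
  first_order ν _ u h := by
    simpa only [add_assoc, add_comm c, add_left_comm c] using hF.first_order ν (u + c) h

/-- The second derivative is the first difference of the increments of the step function and also
the second difference of its values. A bound on increments thus gives the case `l = 1`, and a bound
on values the case `l = 2`. -/
theorem isSmoothTest_interp {n : ℕ} {γ : ℕ → ℝ} {M : ℝ} {l : ℕ} (hγ0 : γ 0 = 0)
    (hγ : ∀ k, n < k → γ k = 0) (hd : ∀ k, |γ (k + 1) - γ k| ≤ M)
    (hl : l = 1 ∨ l = 2 ∧ ∀ k, |γ k| ≤ M) :
    IsSmoothTest l M (Spline.interp n γ) (Spline.interp₁ n γ) := by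
  have hstep : ∀ x, |Spline.stepFun γ (x + 1) - Spline.stepFun γ x| ≤ M := by
    intro x
    unfold Spline.stepFun
    -- For `x < 0` both truncated floors are `0`, so no increment occurs.
    rcases lt_or_ge x 0 with h | h
    · rw [Nat.floor_eq_zero.2 (by linarith : x + 1 < 1),
        Nat.floor_of_nonpos h.le, sub_self, abs_zero]
      exact (abs_nonneg _).trans (hd 0)
    · rw [Nat.floor_add_one h]
      exact hd _
  have hC : ∀ x, |Spline.interp₂ γ x| ≤ M + M := by
    intro x
    have e : Spline.interp₂ γ x = (Spline.stepFun γ (x + 1 + 1) - Spline.stepFun γ (x + 1)) -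
        (Spline.stepFun γ (x + 1) - Spline.stepFun γ x) := by
      rw [Spline.interp₂, add_assoc x, one_add_one_eq_two]; ring
    rw [e]
    exact (abs_sub _ _).trans (add_le_add (hstep _) (hstep _))
  have hm := Spline.measurable_stepFun (γ := γ)
  have hD : ∀ (ν : Measure ℝ) [IsFiniteMeasure ν] (u : ℝ),
      |∫ x, Spline.interp₂ γ (x + u) ∂ν| ≤ M * (smoothD l ν).toReal := by
    intro ν _ u
    rcases hl with rfl | ⟨rfl, hγM⟩
    · have := abs_integral_diff_le_smoothD_one ν
        (φ := fun x => Spline.stepFun γ (x + u + 1) - Spline.stepFun γ (x + u)) (by fun_prop)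
        fun x => hstep _
      convert this using 4 with x
      rw [Spline.interp₂, show x + u + 2 = x + 1 + u + 1 by ring,
        show x + u + 1 = x + 1 + u by ring]
      ring
    · have := abs_integral_diff_le_smoothD_two ν
        (φ := fun x => Spline.stepFun γ (x + u)) (by fun_prop) fun x => hγM _
      convert this using 4 with x
      rw [Spline.interp₂, add_right_comm x u, add_right_comm x u]
  refine ⟨Spline.continuous_interp.measurable, Spline.continuous_interp₁.measurable,
    Spline.exists_bound_interp, Spline.exists_bound_interp₁, fun ν _ u h => ?_, fun ν _ u h => ?_⟩
  · simp only [Spline.interp_add_sub hγ0 hγ hC]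
    have := Spline.abs_integral_remainder_le Spline.measurable_interp₂ hC
      (w := fun s => (1 - s) * h ^ 2) (by fun_prop)
      (fun s hs => mul_nonneg (by linarith [hs.2]) (sq_nonneg h)) ν (hD ν) u h
    refine this.trans (le_of_eq ?_)
    rw [intervalIntegral.integral_mul_const,
      intervalIntegral.integral_sub (g := fun x : ℝ => x) intervalIntegrable_const
        (Continuous.intervalIntegrable continuous_id _ _), integral_id,
      intervalIntegral.integral_const]
    norm_num
    ring
  · simp only [Spline.interp₁_add_sub hγ0 hγ hC]
    simp only [intervalIntegral.integral_const_mul, integral_const_mul]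
    have := Spline.abs_integral_remainder_le Spline.measurable_interp₂ hC
      (w := fun _ => 1) (by fun_prop) (fun s _ => zero_le_one) ν (hD ν) u h
    simp only [one_mul, intervalIntegral.integral_const, sub_zero, one_smul] at this
    rw [abs_mul]
    calc _ ≤ |h| * (M * (smoothD l ν).toReal) := mul_le_mul_of_nonneg_left this (abs_nonneg h)
      _ = _ := by ring

/-! ### Conditioning -/

/-- Disintegrate along `Y`: for a frozen value of `Y` the bound for deterministic `y` applies to the
conditional law of `X`, and the result is averaged again. -/
theorem ofReal_abs_integral_le_lintegral_condD {Ω β : Type*} [MeasurableSpace Ω]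
    [MeasurableSpace β] {P : Measure Ω} [IsFiniteMeasure P] {X : Ω → ℝ} {Y : Ω → β}
    (hX : Measurable X) (hY : Measurable Y) (l : ℕ) {H : β × ℝ → ℝ} (hH : Measurable H)
    (hint : Integrable (fun ω => H (Y ω, X ω)) P) {c : β → ℝ} (hc : ∀ y, 0 ≤ c y)
    (hle : ∀ (ν : Measure ℝ) [IsFiniteMeasure ν] (y : β),
      |∫ x, H (y, x) ∂ν| ≤ c y * (smoothD l ν).toReal) :
    ENNReal.ofReal |∫ ω, H (Y ω, X ω) ∂P| ≤
      ∫⁻ ω, ENNReal.ofReal (c (Y ω)) * condD l X Y P ω ∂P := by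
  have hmap : (P.map Y) ⊗ₘ condDistrib X Y P = P.map fun ω => (Y ω, X ω) :=
    compProd_map_condDistrib hX.aemeasurable
  have hYX : Measurable fun ω => (Y ω, X ω) := hY.prodMk hX
  have hint' : Integrable H (P.map Y ⊗ₘ condDistrib X Y P) := by
    rw [hmap]
    exact (integrable_map_measure hH.aestronglyMeasurable hYX.aemeasurable).2 hint
  have e : ∫ ω, H (Y ω, X ω) ∂P = ∫ ω, ∫ x, H (Y ω, x) ∂(condDistrib X Y P (Y ω)) ∂P := by
    rw [← integral_map hYX.aemeasurable hH.aestronglyMeasurable, ← hmap,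
      Measure.integral_compProd hint', integral_map hY.aemeasurable]
    exact hH.aestronglyMeasurable.integral_condDistrib_map hX.aemeasurable
  rw [e, ← Real.enorm_eq_ofReal_abs]
  refine (enorm_integral_le_lintegral_enorm _).trans (lintegral_mono fun ω => ?_)
  rw [Real.enorm_eq_ofReal_abs]
  refine (ENNReal.ofReal_le_ofReal (hle _ (Y ω))).trans_eq ?_
  rw [ENNReal.ofReal_mul (hc _), condD, ENNReal.ofReal_toReal]
  exact measure_ne_top _ _

/-! ### Local expansions of the total number of points -/

section Counting

variable {Ω J : Type*} [MeasurableSpace J] {Ψ : Ω → Measure J} {μ : Measure J} {A B : Set J}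

theorem centred_univ [IsFiniteMeasure μ] (hA : MeasurableSet A) {ω : Ω}
    (h : IsFiniteMeasure (Ψ ω)) : centred Ψ μ univ ω = centred Ψ μ Aᶜ ω + centred Ψ μ A ω := by
  have h1 := measureReal_add_measureReal_compl (μ := Ψ ω) hA
  have h2 := measureReal_add_measureReal_compl (μ := μ) hA
  simp only [centred, pointCount, ← measureReal_def]
  linarith

theorem pointCount_sdiff (hA : MeasurableSet A) (hAB : A ⊆ B) {ω : Ω}
    (h : IsFiniteMeasure (Ψ ω)) :
    pointCount Ψ (B \ A) ω = pointCount Ψ B ω - pointCount Ψ A ω :=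
  measureReal_sdiff hAB hA

theorem centred_sdiff [IsFiniteMeasure μ] (hA : MeasurableSet A) (hAB : A ⊆ B) {ω : Ω}
    (h : IsFiniteMeasure (Ψ ω)) :
    centred Ψ μ (B \ A) ω = pointCount Ψ B ω - pointCount Ψ A ω - (μ (B \ A)).toReal := by
  rw [centred, pointCount_sdiff hA hAB h]

theorem centred_compl_eq [IsFiniteMeasure μ] (hA : MeasurableSet A) (hB : MeasurableSet B)
    (hAB : A ⊆ B) {ω : Ω} (h : IsFiniteMeasure (Ψ ω)) :
    centred Ψ μ Aᶜ ω = centred Ψ μ Bᶜ ω + centred Ψ μ (B \ A) ω := by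
  have h1 := centred_univ (Ψ := Ψ) (μ := μ) hA h
  have h2 := centred_univ (Ψ := Ψ) (μ := μ) hB h
  have h3 := measureReal_sdiff (μ := μ) hAB hA
  rw [centred_sdiff hA hAB h, ← measureReal_def, h3]
  simp only [centred, measureReal_def] at *
  linarith

end Counting

section Local

variable {Ω J : Type*} [MeasurableSpace Ω] [MeasurableSpace J] {P : Measure Ω}
  {Ψ : Ω → Measure J} {μ : Measure J} {A B : Set J}

theorem measurable_pointCount (hΨ : Measurable Ψ) (hA : MeasurableSet A) :
    Measurable (pointCount Ψ A) :=
  ((Measure.measurable_coe hA).comp hΨ).ennreal_toReal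

theorem measurable_centred (hΨ : Measurable Ψ) (hA : MeasurableSet A) :
    Measurable (centred Ψ μ A) :=
  (measurable_pointCount hΨ hA).sub_const _

theorem integrable_pointCount (hΨ : Measurable Ψ) (hfin : ∫⁻ ω, Ψ ω univ ∂P ≠ ∞)
    (hA : MeasurableSet A) : Integrable (pointCount Ψ A) P :=
  integrable_toReal_of_lintegral_ne_top ((Measure.measurable_coe hA).comp hΨ).aemeasurable
    (ne_top_of_le_ne_top hfin (lintegral_mono fun _ => measure_mono (subset_univ _)))

theorem integrable_centred [IsFiniteMeasure P] (hΨ : Measurable Ψ)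
    (hfin : ∫⁻ ω, Ψ ω univ ∂P ≠ ∞) (hA : MeasurableSet A) : Integrable (centred Ψ μ A) P :=
  (integrable_pointCount hΨ hfin hA).sub (integrable_const _)

theorem ae_isFiniteMeasure (hΨ : Measurable Ψ) (hfin : ∫⁻ ω, Ψ ω univ ∂P ≠ ∞) :
    ∀ᵐ ω ∂P, IsFiniteMeasure (Ψ ω) :=
  (ae_lt_top ((Measure.measurable_coe MeasurableSet.univ).comp hΨ) hfin).mono fun _ h => ⟨h⟩

variable {l : ℕ} {M : ℝ} {F F₁ : ℝ → ℝ}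

theorem IsSmoothTest.integrable_comp [IsFiniteMeasure P] (hF : IsSmoothTest l M F F₁)
    {X : Ω → ℝ} (hX : Measurable X) : Integrable (fun ω => F (X ω)) P := by
  obtain ⟨C, hC⟩ := hF.bounded
  exact Integrable.of_bound (hF.measurable.comp hX).aestronglyMeasurable C (.of_forall fun _ => hC _)

theorem IsSmoothTest.integrable_deriv_comp [IsFiniteMeasure P] (hF : IsSmoothTest l M F F₁)
    {X : Ω → ℝ} (hX : Measurable X) : Integrable (fun ω => F₁ (X ω)) P := by
  obtain ⟨C, hC⟩ := hF.bounded_deriv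
  exact Integrable.of_bound (hF.measurable_deriv.comp hX).aestronglyMeasurable C
    (.of_forall fun _ => hC _)

theorem IsSmoothTest.integrable_mul_deriv_comp (hF : IsSmoothTest l M F F₁)
    {X Z : Ω → ℝ} (hX : Measurable X) (hZ : Integrable Z P) :
    Integrable (fun ω => Z ω * F₁ (X ω)) P := by
  obtain ⟨C, hC⟩ := hF.bounded_deriv
  exact hZ.mul_bdd (c := C) (hF.measurable_deriv.comp hX).aestronglyMeasurable (.of_forall fun _ => hC _)

variable [IsFiniteMeasure P]

/-- Splitting of the expectation of `F` into Taylor remainders and principal terms. -/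
theorem integral_centred_univ_eq (hF : IsSmoothTest l M F F₁) (hΨ : Measurable Ψ)
    (hfin : ∫⁻ ω, Ψ ω univ ∂P ≠ ∞) (hA : MeasurableSet A) (hB : MeasurableSet B) :
    ∫ ω, F (centred Ψ μ univ ω) ∂P =
      ∫ ω, (F (centred Ψ μ univ ω) - F (centred Ψ μ Aᶜ ω) -
        centred Ψ μ A ω * F₁ (centred Ψ μ Aᶜ ω)) ∂P +
      ∫ ω, centred Ψ μ A ω * (F₁ (centred Ψ μ Aᶜ ω) - F₁ (centred Ψ μ Bᶜ ω)) ∂P +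
      ∫ ω, F (centred Ψ μ Aᶜ ω) ∂P + ∫ ω, centred Ψ μ A ω * F₁ (centred Ψ μ Bᶜ ω) ∂P := by
  have i1 := hF.integrable_comp (P := P) (measurable_centred (μ := μ) hΨ MeasurableSet.univ)
  have i2 := hF.integrable_comp (P := P) (measurable_centred (μ := μ) hΨ hA.compl)
  have i3 := hF.integrable_mul_deriv_comp (P := P) (measurable_centred (μ := μ) hΨ hA.compl)
    (integrable_centred (μ := μ) hΨ hfin hA)
  have i4 := hF.integrable_mul_deriv_comp (P := P) (measurable_centred (μ := μ) hΨ hB.compl)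
    (integrable_centred (μ := μ) hΨ hfin hA)
  simp only [mul_sub]
  rw [integral_sub (i1.sub' i2) i3, integral_sub i1 i2, integral_sub i3 i4]
  ring

variable [IsFiniteMeasure μ]

/-- Given `Ψ(A)` the displacement `Ψ'(A)` is a constant, and only the count outside `A` is random,
so the second-order estimate applies conditionally. -/
theorem ofReal_abs_second_order_le (hM : 0 ≤ M) (hF : IsSmoothTest l M F F₁) (hΨ : Measurable Ψ)
    (hfin : ∫⁻ ω, Ψ ω univ ∂P ≠ ∞) (hA : MeasurableSet A) :
    ENNReal.ofReal |∫ ω, (F (centred Ψ μ univ ω) - F (centred Ψ μ Aᶜ ω) -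
      centred Ψ μ A ω * F₁ (centred Ψ μ Aᶜ ω)) ∂P| ≤
      ENNReal.ofReal M * (1 / 2 * squareTerm l Ψ P μ A) := by
  have hFm := hF.measurable
  have hFm' := hF.measurable_deriv
  set H : ℝ × ℝ → ℝ := fun z => F (z.2 + -(μ Aᶜ).toReal + (z.1 - (μ A).toReal)) -
    F (z.2 + -(μ Aᶜ).toReal) - (z.1 - (μ A).toReal) * F₁ (z.2 + -(μ Aᶜ).toReal) with hHdef
  have hH : Measurable H := by fun_prop
  have hX := measurable_pointCount hΨ hA.compl
  have hY := measurable_pointCount hΨ hA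
  have hae : (fun ω => F (centred Ψ μ univ ω) - F (centred Ψ μ Aᶜ ω) -
      centred Ψ μ A ω * F₁ (centred Ψ μ Aᶜ ω)) =ᵐ[P]
      fun ω => H (pointCount Ψ A ω, pointCount Ψ Aᶜ ω) := by
    filter_upwards [ae_isFiniteMeasure hΨ hfin] with ω hω
    rw [centred_univ hA hω, hHdef]
    simp only [centred, sub_eq_add_neg]
  have hint : Integrable (fun ω => H (pointCount Ψ A ω, pointCount Ψ Aᶜ ω)) P := by
    refine Integrable.congr ?_ hae
    exact ((hF.integrable_comp (measurable_centred hΨ MeasurableSet.univ)).sub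
      (hF.integrable_comp (measurable_centred hΨ hA.compl))).sub
      (hF.integrable_mul_deriv_comp (measurable_centred hΨ hA.compl)
        (integrable_centred hΨ hfin hA))
  rw [integral_congr_ae hae]
  refine (ofReal_abs_integral_le_lintegral_condD hX hY l hH hint
    (c := fun y => M * ((y - (μ A).toReal) ^ 2 / 2)) (fun y => by positivity)
    fun ν _ y => hF.second_order ν (-(μ Aᶜ).toReal) (y - (μ A).toReal)).trans_eq ?_
  rw [squareTerm, ← lintegral_const_mul' _ _ (by simp), ← lintegral_const_mul' _ _ (by simp)]
  refine lintegral_congr fun ω => ?_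
  rw [ENNReal.ofReal_mul hM, ENNReal.ofReal_div_of_pos two_pos, div_eq_mul_inv, centred]
  simp only [one_div, ENNReal.ofReal_ofNat]
  ring

/-- Conditioning on both `Ψ(A)` and `Ψ(B)` freezes the factor `Ψ'(A)` and the displacement `Ψ'(B \
A)`. -/
theorem ofReal_abs_cross_le (hM : 0 ≤ M) (hF : IsSmoothTest l M F F₁) (hΨ : Measurable Ψ)
    (hfin : ∫⁻ ω, Ψ ω univ ∂P ≠ ∞) (hA : MeasurableSet A) (hB : MeasurableSet B) (hAB : A ⊆ B) :
    ENNReal.ofReal |∫ ω, centred Ψ μ A ω *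
      (F₁ (centred Ψ μ Aᶜ ω) - F₁ (centred Ψ μ Bᶜ ω)) ∂P| ≤
      ENNReal.ofReal M * crossTerm l Ψ P μ A B := by
  have hFm' := hF.measurable_deriv
  set H : (ℝ × ℝ) × ℝ → ℝ := fun z => (z.1.1 - (μ A).toReal) *
    (F₁ (z.2 + -(μ Bᶜ).toReal + (z.1.2 - z.1.1 - (μ (B \ A)).toReal)) -
      F₁ (z.2 + -(μ Bᶜ).toReal)) with hHdef
  have hH : Measurable H := by fun_prop
  have hX := measurable_pointCount hΨ hB.compl
  have hY := (measurable_pointCount hΨ hA).prodMk (measurable_pointCount hΨ hB)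
  have hae : (fun ω => centred Ψ μ A ω *
      (F₁ (centred Ψ μ Aᶜ ω) - F₁ (centred Ψ μ Bᶜ ω))) =ᵐ[P]
      fun ω => H ((pointCount Ψ A ω, pointCount Ψ B ω), pointCount Ψ Bᶜ ω) := by
    filter_upwards [ae_isFiniteMeasure hΨ hfin] with ω hω
    rw [centred_compl_eq hA hB hAB hω, centred_sdiff hA hAB hω, hHdef]
    simp only [centred, sub_eq_add_neg]
  have hint : Integrable
      (fun ω => H ((pointCount Ψ A ω, pointCount Ψ B ω), pointCount Ψ Bᶜ ω)) P := by
    refine Integrable.congr ?_ hae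
    simp only [mul_sub]
    exact (hF.integrable_mul_deriv_comp (measurable_centred hΨ hA.compl)
        (integrable_centred hΨ hfin hA)).sub
      (hF.integrable_mul_deriv_comp (measurable_centred hΨ hB.compl)
        (integrable_centred hΨ hfin hA))
  rw [integral_congr_ae hae]
  refine (ofReal_abs_integral_le_lintegral_condD hX hY l hH hint
    (c := fun y => M * |(y.1 - (μ A).toReal) * (y.2 - y.1 - (μ (B \ A)).toReal)|)
    (fun y => by positivity) fun ν _ y => ?_).trans_eq ?_
  · simp only [hHdef, integral_const_mul, abs_mul]
    refine (mul_le_mul_of_nonneg_left (hF.first_order ν _ _) (abs_nonneg _)).trans_eq ?_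
    ring
  · rw [crossTerm, ← lintegral_const_mul' _ _ (by simp)]
    refine lintegral_congr_ae ?_
    filter_upwards [ae_isFiniteMeasure hΨ hfin] with ω hω
    rw [centred_sdiff hA hAB hω, ENNReal.ofReal_mul hM, centred, mul_assoc]

theorem ofReal_abs_first_order_le (hM : 0 ≤ M) (hF : IsSmoothTest l M F F₁) (hΨ : Measurable Ψ)
    (hfin : ∫⁻ ω, Ψ ω univ ∂P ≠ ∞) (hB : MeasurableSet B) :
    ENNReal.ofReal |∫ ω, (F₁ (centred Ψ μ univ ω) - F₁ (centred Ψ μ Bᶜ ω)) ∂P| ≤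
      ENNReal.ofReal M * absTerm l Ψ P μ B := by
  have hFm' := hF.measurable_deriv
  set H : ℝ × ℝ → ℝ := fun z => F₁ (z.2 + -(μ Bᶜ).toReal + (z.1 - (μ B).toReal)) -
    F₁ (z.2 + -(μ Bᶜ).toReal) with hHdef
  have hH : Measurable H := by fun_prop
  have hX := measurable_pointCount hΨ hB.compl
  have hY := measurable_pointCount hΨ hB
  have hae : (fun ω => F₁ (centred Ψ μ univ ω) - F₁ (centred Ψ μ Bᶜ ω)) =ᵐ[P]
      fun ω => H (pointCount Ψ B ω, pointCount Ψ Bᶜ ω) := by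
    filter_upwards [ae_isFiniteMeasure hΨ hfin] with ω hω
    rw [centred_univ hB hω, hHdef]
    simp only [centred, sub_eq_add_neg]
  have hint : Integrable (fun ω => H (pointCount Ψ B ω, pointCount Ψ Bᶜ ω)) P := by
    refine Integrable.congr ?_ hae
    exact (hF.integrable_deriv_comp (measurable_centred hΨ MeasurableSet.univ)).sub
      (hF.integrable_deriv_comp (measurable_centred hΨ hB.compl))
  rw [integral_congr_ae hae]
  refine (ofReal_abs_integral_le_lintegral_condD hX hY l hH hint
    (c := fun y => M * |y - (μ B).toReal|) (fun y => by positivity)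
    fun ν _ y => hF.first_order ν (-(μ Bᶜ).toReal) (y - (μ B).toReal)).trans_eq ?_
  rw [absTerm, ← lintegral_const_mul' _ _ (by simp)]
  refine lintegral_congr fun ω => ?_
  rw [ENNReal.ofReal_mul hM, centred, mul_assoc]

end Local

/-! ### Comparison of the process with its Palm processes -/

section Palm

variable {Ω J : Type*} [MeasurableSpace Ω] [MeasurableSpace J] {P : Measure Ω}
  {Φ : Ω → Measure J} {l : ℕ} {M : ℝ} {F F₁ : ℝ → ℝ}

theorem integral_pointCount (hΦ : Measurable Φ) (hμ : meanMeasure Φ P univ < ∞)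
    {A : Set J} (hA : MeasurableSet A) :
    ∫ ω, pointCount Φ A ω ∂P = (meanMeasure Φ P A).toReal := by
  have hm : AEMeasurable (fun ω => Φ ω A) P := ((Measure.measurable_coe hA).comp hΦ).aemeasurable
  have hb := Measure.bind_apply hA hΦ.aemeasurable (m := P)
  have hne : ∫⁻ ω, Φ ω A ∂P ≠ ∞ := by
    rw [← hb]
    exact ((measure_mono (subset_univ _)).trans_lt hμ).ne
  rw [meanMeasure, hb]
  exact integral_toReal hm (ae_lt_top' hm hne)

theorem lintegral_univ_ne_top (hΦ : Measurable Φ) (hμ : meanMeasure Φ P univ < ∞) :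
    ∫⁻ ω, Φ ω univ ∂P ≠ ∞ := by
  rw [← Measure.bind_apply MeasurableSet.univ hΦ.aemeasurable]
  exact hμ.ne

theorem integral_centred [IsProbabilityMeasure P] (hΦ : Measurable Φ)
    (hμ : meanMeasure Φ P univ < ∞) {A : Set J} (hA : MeasurableSet A) :
    ∫ ω, centred Φ (meanMeasure Φ P) A ω ∂P = 0 := by
  simp only [centred]
  rw [integral_sub (integrable_pointCount hΦ (lintegral_univ_ne_top hΦ hμ) hA)
    (integrable_const _), integral_pointCount hΦ hμ hA, integral_const, probReal_univ, one_smul,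
    sub_self]

theorem integral_centred_congr_law {Q : Measure (Measure J)} {μ : Measure J} {A : Set J}
    (hΦ : Measurable Φ) (hA : MeasurableSet A)
    (hlaw : Q.map (fun ν => ν A) = P.map (fun ω => Φ ω A)) {f : ℝ → ℝ} (hf : Measurable f) :
    ∫ ν, f (centred id μ A ν) ∂Q = ∫ ω, f (centred Φ μ A ω) ∂P := by
  have hm : Measurable fun x : ℝ≥0∞ => f (x.toReal - (μ A).toReal) :=
    hf.comp (ENNReal.measurable_toReal.sub_const _)
  have h1 := integral_map (μ := Q) (Measure.measurable_coe hA).aemeasurable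
    hm.aestronglyMeasurable
  have h2 := integral_map (μ := P) ((Measure.measurable_coe hA).comp hΦ).aemeasurable
    hm.aestronglyMeasurable
  exact h1.symm.trans ((congrArg
    (fun ρ : Measure ℝ≥0∞ => ∫ x, f (x.toReal - (μ A).toReal) ∂ρ) hlaw).trans h2)

/-- Zeroth-order terms agree by equality of laws outside `A`. The first-order Palm term factorises
as `E Φ'_α(A)` times an expectation of `F₁` outside `B`, while that of `Φ` vanishes because `Φ'(A)`
has mean zero. -/
theorem ofReal_abs_palm_remainder_le [IsProbabilityMeasure P] (hΦ : Measurable Φ)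
    (hμ : meanMeasure Φ P univ < ∞) (Q : Measure (Measure J)) [IsProbabilityMeasure Q]
    (hQ : ∫⁻ ν, ν univ ∂Q ≠ ∞) {A B : Set J} (hA : MeasurableSet A) (hB : MeasurableSet B)
    (hAB : A ⊆ B)
    (hlawA : Q.map (fun ν => ν Aᶜ) = P.map (fun ω => Φ ω Aᶜ))
    (hlawB : Q.map (fun ν => ν Bᶜ) = P.map (fun ω => Φ ω Bᶜ))
    (hindQ : IndepFun (fun ν : Measure J => ν A) (fun ν : Measure J => ν Bᶜ) Q)
    (hindP : IndepFun (fun ω => Φ ω A) (fun ω => Φ ω Bᶜ) P)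
    (hM : 0 ≤ M) (hF : IsSmoothTest l M F F₁) :
    ENNReal.ofReal |∫ ν, F (centred id (meanMeasure Φ P) univ ν) ∂Q
        - ∫ ω, F (centred Φ (meanMeasure Φ P) univ ω) ∂P
        - (∫ ν, centred id (meanMeasure Φ P) univ ν ∂Q) *
          ∫ ω, F₁ (centred Φ (meanMeasure Φ P) univ ω) ∂P| ≤
      ENNReal.ofReal M * theta l Φ P Q A B := by
  have hP := lintegral_univ_ne_top hΦ hμ
  have : IsFiniteMeasure (meanMeasure Φ P) := ⟨hμ⟩
  have hU : MeasurableSet (univ : Set J) := MeasurableSet.univ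
  have hid : Measurable (id : Measure J → Measure J) := measurable_id
  simp only [theta]
  set μ := meanMeasure Φ P with hμdef
  set e : ℝ := ∫ ν, centred id μ A ν ∂Q with he
  -- The points outside `A` contribute nothing: their count has the law of `Φ(Aᶜ)`, whose mean is
  -- `μ(Aᶜ)`.
  have heU : ∫ ν, centred id μ univ ν ∂Q = e := by
    have h1 : ∫ ν, centred id μ univ ν ∂Q = ∫ ν, (centred id μ Aᶜ ν + centred id μ A ν) ∂Q :=
      integral_congr_ae ((ae_isFiniteMeasure hid hQ).mono fun ν hν => centred_univ hA hν)
    rw [h1, integral_add (integrable_centred hid hQ hA.compl) (integrable_centred hid hQ hA),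
      integral_centred_congr_law hΦ hA.compl hlawA (f := fun x => x) measurable_id,
      integral_centred hΦ hμ hA.compl, zero_add]
  have cm : ∀ {c : ℝ}, Measurable fun x : ℝ≥0∞ => x.toReal - c := fun {c} =>
    ENNReal.measurable_toReal.sub_const _
  have hprodQ : ∫ ν, centred id μ A ν * F₁ (centred id μ Bᶜ ν) ∂Q =
      e * ∫ ω, F₁ (centred Φ μ Bᶜ ω) ∂P := by
    rw [← integral_centred_congr_law hΦ hB.compl hlawB hF.measurable_deriv]
    exact (hindQ.comp cm (hF.measurable_deriv.comp cm)).integral_fun_mul_eq_mul_integral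
      (measurable_centred hid hA).aestronglyMeasurable
      (hF.measurable_deriv.comp (measurable_centred hid hB.compl)).aestronglyMeasurable
  have hprodP : ∫ ω, centred Φ μ A ω * F₁ (centred Φ μ Bᶜ ω) ∂P = 0 := by
    have := (hindP.comp cm (hF.measurable_deriv.comp cm)).integral_fun_mul_eq_mul_integral
      (measurable_centred (μ := μ) hΦ hA).aestronglyMeasurable
      (hF.measurable_deriv.comp (measurable_centred (μ := μ) hΦ hB.compl)).aestronglyMeasurable
    refine this.trans (mul_eq_zero_of_left ?_ _)
    exact integral_centred hΦ hμ hA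
  have hsplit : ∫ ν, F (centred id μ univ ν) ∂Q - ∫ ω, F (centred Φ μ univ ω) ∂P
        - (∫ ν, centred id μ univ ν ∂Q) * ∫ ω, F₁ (centred Φ μ univ ω) ∂P =
      -(e * ∫ ω, (F₁ (centred Φ μ univ ω) - F₁ (centred Φ μ Bᶜ ω)) ∂P)
      + ∫ ν, (F (centred id μ univ ν) - F (centred id μ Aᶜ ν) -
        centred id μ A ν * F₁ (centred id μ Aᶜ ν)) ∂Q
      + -∫ ω, (F (centred Φ μ univ ω) - F (centred Φ μ Aᶜ ω) -
        centred Φ μ A ω * F₁ (centred Φ μ Aᶜ ω)) ∂P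
      + ∫ ν, centred id μ A ν * (F₁ (centred id μ Aᶜ ν) - F₁ (centred id μ Bᶜ ν)) ∂Q
      + -∫ ω, centred Φ μ A ω * (F₁ (centred Φ μ Aᶜ ω) - F₁ (centred Φ μ Bᶜ ω)) ∂P := by
    rw [heU, integral_centred_univ_eq hF hid hQ hA hB, integral_centred_univ_eq hF hΦ hP hA hB, hprodQ, hprodP,
      integral_centred_congr_law hΦ hA.compl hlawA hF.measurable,
      integral_sub (hF.integrable_deriv_comp (measurable_centred hΦ hU))
        (hF.integrable_deriv_comp (measurable_centred hΦ hB.compl))]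
    ring
  have habs : ∀ x y : ℝ, ENNReal.ofReal |x + y| ≤ ENNReal.ofReal |x| + ENNReal.ofReal |y| :=
    fun x y => by
      rw [← ENNReal.ofReal_add (abs_nonneg _) (abs_nonneg _)]
      exact ENNReal.ofReal_le_ofReal (abs_add_le x y)
  have hid' : ∫⁻ ν, (id ν : Measure J) univ ∂Q ≠ ∞ := hQ
  rw [hsplit]
  refine (habs _ _).trans ?_
  rw [mul_add]
  refine add_le_add ((habs _ _).trans ?_) ?_
  · rw [mul_add]
    refine add_le_add ((habs _ _).trans ?_) (ofReal_abs_cross_le hM hF hid hid' hA hB hAB)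
    rw [mul_add]
    refine add_le_add ((habs _ _).trans ?_) ?_
    · rw [mul_add]
      refine add_le_add ?_ (ofReal_abs_second_order_le hM hF hid hid' hA)
      rw [abs_neg, abs_mul, ENNReal.ofReal_mul (abs_nonneg _), mul_left_comm]
      gcongr
      exact ofReal_abs_first_order_le hM hF hΦ hP hB
    · rw [abs_neg]
      exact ofReal_abs_second_order_le hM hF hΦ hP hA
  · rw [abs_neg]
    exact ofReal_abs_cross_le hM hF hΦ hP hA hB hAB

end Palm

/-! ### The Palm identity and the Stein operator -/

section PalmIdentity

variable {Ω J : Type*} [MeasurableSpace Ω] [MeasurableSpace J] {P : Measure Ω}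
  {Φ : Ω → Measure J} {κ : Kernel J (Measure J)}

/-- The mixture of the Palm laws is the law of `Φ` size-biased by its total number of points. This
extends the Palm identity from nonnegative to integrable functions of the process. -/
theorem IsPalmKernel.bind_eq (hΦ : Measurable Φ) (hκ : IsPalmKernel Φ P κ) :
    (meanMeasure Φ P).bind κ = (P.map Φ).withDensity (fun ν => ν univ) := by
  ext s hs
  have h1 := hκ (fun _ ν => s.indicator (fun _ => 1) ν)
    ((measurable_const.indicator hs).comp measurable_snd)
  simp only [lintegral_const, lintegral_indicator_const hs, one_mul] at h1
  have hm : Measurable fun ν : Measure J => ν univ := Measure.measurable_coe MeasurableSet.univ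
  rw [Measure.bind_apply hs κ.aemeasurable, ← h1, withDensity_apply _ hs, ← lintegral_indicator hs,
    lintegral_map (hm.indicator hs) hΦ]
  refine lintegral_congr fun ω => ?_
  by_cases h : Φ ω ∈ s <;> simp [h]

theorem IsPalmKernel.integrable_and_integral_eq [IsFiniteMeasure P] (hΦ : Measurable Φ)
    (hμ : meanMeasure Φ P univ < ∞) (hκ : IsPalmKernel Φ P κ) [IsMarkovKernel κ]
    {f : Measure J → ℝ} (hf : Measurable f)
    (hint : Integrable (fun ω => pointCount Φ univ ω * f (Φ ω)) P) :
    Integrable (fun α => ∫ ν, f ν ∂(κ α)) (meanMeasure Φ P) ∧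
      ∫ α, ∫ ν, f ν ∂(κ α) ∂(meanMeasure Φ P) = ∫ ω, pointCount Φ univ ω * f (Φ ω) ∂P := by
  have hm : Measurable fun ν : Measure J => ν univ := Measure.measurable_coe MeasurableSet.univ
  have hlt : ∀ᵐ ν ∂(P.map Φ), ν univ < ∞ := by
    rw [ae_map_iff hΦ.aemeasurable (measurableSet_lt hm measurable_const)]
    exact ae_lt_top (hm.comp hΦ) (lintegral_univ_ne_top hΦ hμ)
  have hg : Measurable fun ν : Measure J => (ν univ).toReal • f ν := hm.ennreal_toReal.smul hf
  have hint' : Integrable f ((meanMeasure Φ P).bind κ) := by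
    rw [hκ.bind_eq hΦ, integrable_withDensity_iff_integrable_smul' hm hlt,
      integrable_map_measure hg.aestronglyMeasurable hΦ.aemeasurable]
    exact hint
  have e : ∫ ν, f ν ∂((meanMeasure Φ P).bind κ) = ∫ ω, pointCount Φ univ ω * f (Φ ω) ∂P := by
    rw [hκ.bind_eq hΦ, integral_withDensity_eq_integral_toReal_smul hm hlt,
      integral_map hΦ.aemeasurable hg.aestronglyMeasurable]
    rfl
  rw [← e]
  rw [Measure.comp_eq_comp_const_apply] at hint' ⊢
  refine ⟨?_, ?_⟩
  · simpa using hint'.integral_comp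
  · simpa using (Kernel.integral_comp hint').symm

/-- Apply the Palm identity to the total count: the `μ`-integral of the mean Palm count is the
second moment of `Φ(J)`, hence finite. -/
theorem IsPalmKernel.ae_lintegral_univ_ne_top [IsFiniteMeasure P] (hΦ : Measurable Φ)
    (hμ : meanMeasure Φ P univ < ∞) (hκ : IsPalmKernel Φ P κ)
    (hint : Integrable (fun ω => pointCount Φ univ ω * pointCount Φ univ ω) P) :
    ∀ᵐ α ∂(meanMeasure Φ P), ∫⁻ ν, ν univ ∂(κ α) ≠ ∞ := by
  have hm : Measurable fun ν : Measure J => ν univ := Measure.measurable_coe MeasurableSet.univ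
  have h := hκ (fun _ ν => ν univ) (hm.comp measurable_snd)
  simp only [lintegral_const] at h
  have hlt : ∫⁻ ω, Φ ω univ * Φ ω univ ∂P ≠ ∞ := by
    refine ne_of_eq_of_ne (lintegral_congr_ae ?_) hint.lintegral_lt_top.ne
    filter_upwards [ae_isFiniteMeasure hΦ (lintegral_univ_ne_top hΦ hμ)] with ω hω
    rw [pointCount, ENNReal.ofReal_mul ENNReal.toReal_nonneg,
      ENNReal.ofReal_toReal (measure_ne_top _ _)]
  rw [h] at hlt
  exact (ae_lt_top hm.lintegral_kernel hlt).mono fun _ h => h.ne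

theorem ofReal_abs_stein_le [IsProbabilityMeasure P] (hΦ : Measurable Φ)
    (hμ : meanMeasure Φ P univ < ∞) [IsMarkovKernel κ] (hκ : IsPalmKernel Φ P κ)
    {A B : J → Set J} (hA : ∀ α, MeasurableSet (A α)) (hB : ∀ α, MeasurableSet (B α))
    (hAB : ∀ α, A α ⊆ B α)
    (hlawA : ∀ᵐ α ∂(meanMeasure Φ P),
      (κ α).map (fun ν => ν (A α)ᶜ) = P.map (fun ω => Φ ω (A α)ᶜ))
    (hlawB : ∀ᵐ α ∂(meanMeasure Φ P),
      (κ α).map (fun ν => ν (B α)ᶜ) = P.map (fun ω => Φ ω (B α)ᶜ))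
    (hindepPalm : ∀ᵐ α ∂(meanMeasure Φ P),
      IndepFun (fun ν : Measure J => ν (A α)) (fun ν : Measure J => ν (B α)ᶜ) (κ α))
    (hindep : ∀ᵐ α ∂(meanMeasure Φ P),
      IndepFun (fun ω => Φ ω (A α)) (fun ω => Φ ω (B α)ᶜ) P)
    (hL2 : MemLp (totalCentred Φ P) 2 P) {l : ℕ} {M : ℝ} {F F₁ : ℝ → ℝ} (hM : 0 ≤ M)
    (hF : IsSmoothTest l M F F₁) :
    ENNReal.ofReal |∫ ω, totalCentred Φ P ω * F (totalCentred Φ P ω) ∂P -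
        variance (totalCentred Φ P) P * ∫ ω, F₁ (totalCentred Φ P ω) ∂P| ≤
      ENNReal.ofReal M * ∫⁻ α, theta l Φ P (κ α) (A α) (B α) ∂(meanMeasure Φ P) := by
  have hU : MeasurableSet (univ : Set J) := MeasurableSet.univ
  have hfinite : IsFiniteMeasure (meanMeasure Φ P) := ⟨hμ⟩
  have hfin := lintegral_univ_ne_top hΦ hμ
  set W := totalCentred Φ P with hWdef
  set m : ℝ := (meanMeasure Φ P univ).toReal with hm
  have hWm : Measurable W := measurable_centred hΦ hU
  have hW0 : ∫ ω, W ω ∂P = 0 := integral_centred hΦ hμ hU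
  have hWint : Integrable W P := integrable_centred hΦ hfin hU
  have hN : ∀ ω, pointCount Φ univ ω = W ω + m := fun ω => by
    simp only [hWdef, totalCentred, centred, hm]; ring
  have hvar : variance W P = ∫ ω, W ω * W ω ∂P := by
    rw [variance_of_integral_eq_zero hWm.aemeasurable hW0]
    simp only [sq]
  have hWW : Integrable (fun ω => W ω * W ω) P := by simpa only [sq] using hL2.integrable_sq
  obtain ⟨C, hC⟩ := hF.bounded
  have hWF : Integrable (fun ω => W ω * F (W ω)) P :=
    hWint.mul_bdd (c := C) (hF.measurable.comp hWm).aestronglyMeasurable (.of_forall fun _ => hC _)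
  have hFW : Integrable (fun ω => F (W ω)) P := hF.integrable_comp hWm
  have hid : Measurable (id : Measure J → Measure J) := measurable_id
  have hcm : Measurable (centred id (meanMeasure Φ P) univ) := measurable_centred hid hU
  have i1 : Integrable (fun ω => pointCount Φ univ ω * F (W ω)) P := by
    simp only [hN, add_mul]
    exact hWF.add (hFW.const_mul m)
  have i2 : Integrable (fun ω => pointCount Φ univ ω * W ω) P := by
    simp only [hN, add_mul]
    exact hWW.add (hWint.const_mul m)
  have i3 : Integrable (fun ω => pointCount Φ univ ω * pointCount Φ univ ω) P := by
    have := i2.add ((integrable_pointCount hΦ hfin hU).mul_const m)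
    refine this.congr (.of_forall fun ω => ?_)
    simp only [Pi.add_apply, hN]; ring
  obtain ⟨j1, e1⟩ := hκ.integrable_and_integral_eq hΦ hμ (hF.measurable.comp hcm) i1
  obtain ⟨j2, e2⟩ := hκ.integrable_and_integral_eq hΦ hμ hcm i2
  have e1' : ∫ ω, pointCount Φ univ ω * F (W ω) ∂P =
      ∫ ω, W ω * F (W ω) ∂P + m * ∫ ω, F (W ω) ∂P := by
    simp only [hN, add_mul]
    rw [integral_add hWF (hFW.const_mul m), integral_const_mul]
  have e2' : ∫ ω, pointCount Φ univ ω * W ω ∂P = variance W P := by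
    simp only [hN, add_mul]
    rw [integral_add hWW (hWint.const_mul m), integral_const_mul, hW0, hvar, mul_zero, add_zero]
  simp only [Function.comp_apply] at j1
  -- The Palm identity for `F` gives the first two terms; for the centred total it gives `σ²` as the
  -- integral of the Palm means.
  have key : ∫ ω, W ω * F (W ω) ∂P - variance W P * ∫ ω, F₁ (W ω) ∂P =
      ∫ α, (∫ ν, F (centred id (meanMeasure Φ P) univ ν) ∂(κ α) - ∫ ω, F (W ω) ∂P -
        (∫ ν, centred id (meanMeasure Φ P) univ ν ∂(κ α)) * ∫ ω, F₁ (W ω) ∂P)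
          ∂(meanMeasure Φ P) := by
    rw [integral_sub (Integrable.sub' j1 (integrable_const _)) (j2.mul_const _),
      integral_sub j1 (integrable_const _), integral_mul_const, integral_const]
    have e1'' := e1.trans e1'
    have e2'' := e2.trans e2'
    simp only [Function.comp_apply] at e1''
    rw [e1'', e2'', smul_eq_mul, measureReal_def]
    ring
  rw [key, ← Real.enorm_eq_ofReal_abs, ← lintegral_const_mul' _ _ (by simp)]
  refine (enorm_integral_le_lintegral_enorm _).trans (lintegral_mono_ae ?_)
  filter_upwards [hlawA, hlawB, hindepPalm, hindep, hκ.ae_lintegral_univ_ne_top hΦ hμ i3]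
    with α h1 h2 h3 h4 h5
  rw [Real.enorm_eq_ofReal_abs]
  exact ofReal_abs_palm_remainder_le hΦ hμ (κ α) h5 (hA α) (hB α) (hAB α) h1 h2 h3 h4 hM hF

end PalmIdentity

/-! ### Parameters of the approximating binomial distribution -/

section Parameters

variable (a : ℝ) {v : ℝ}

theorem natCeil_eq (hv : 1 < v) : ((⌈4 * v⌉₊ : ℕ) : ℝ) = 4 * v + deltaParam v := by
  have h : ((⌈4 * v⌉₊ : ℕ) : ℝ) = (⌈4 * v⌉ : ℝ) := by
    have := natCast_ceil_eq_intCast_ceil (R := ℝ) (a := 4 * v) (by linarith)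
    exact this
  rw [h, deltaParam, Int.fract, Int.floor_neg]
  push_cast
  ring

theorem five_le_natCeil (hv : 1 < v) : (5 : ℝ) ≤ (⌈4 * v⌉₊ : ℕ) := by
  have : 4 < ⌈4 * v⌉₊ := Nat.lt_ceil.2 (by push_cast; linarith)
  exact_mod_cast this

theorem tParam_mul (hv : 1 < v) :
    tParam a v * (⌈4 * v⌉₊ : ℕ) = Int.fract (a + (⌈4 * v⌉₊ : ℕ) / 2) := by
  have h5 := five_le_natCeil hv
  rw [tParam, ← natCeil_eq hv, div_mul_cancel₀ _ (by linarith)]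
  congr 1
  rw [natCeil_eq hv]
  ring

theorem tParam_nonneg (hv : 1 < v) : 0 ≤ tParam a v := by
  rw [tParam, ← natCeil_eq hv]
  exact div_nonneg (Int.fract_nonneg _) (Nat.cast_nonneg _)

theorem tParam_mul_lt (hv : 1 < v) : tParam a v * (⌈4 * v⌉₊ : ℕ) < 1 := by
  rw [tParam_mul a hv]; exact Int.fract_lt_one _

theorem tParam_le (hv : 1 < v) : tParam a v ≤ 1 / (4 * v) := by
  have h := tParam_mul_lt a hv
  have hn : 4 * v ≤ (⌈4 * v⌉₊ : ℕ) := Nat.le_ceil _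
  have ht := tParam_nonneg a hv
  rw [le_div_iff₀ (by linarith)]
  nlinarith

theorem tParam_le_fifth (hv : 1 < v) : tParam a v ≤ 1 / 5 := by
  have h := tParam_mul_lt a hv
  have h5 := five_le_natCeil hv
  have ht := tParam_nonneg a hv
  nlinarith

/-- This is the purpose of `t`: it shifts the mean `n/2` so that the centred binomial lives on `a +
ℤ`. -/
theorem exists_int_mean (hv : 1 < v) :
    ∃ z : ℤ, (⌈4 * v⌉₊ : ℕ) * (1 / 2 - tParam a v) = (z : ℝ) - a := by
  have h := tParam_mul a hv
  refine ⟨⌊a + (⌈4 * v⌉₊ : ℕ) / 2⌋, ?_⟩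
  rw [Int.fract] at h
  linarith

/-- The difference is `-δ/4 + n t²`, where rounding gives `0 ≤ δ < 1` and `n t < 1` gives `n t² ≤ t
≤ 1/5`. -/
theorem abs_sub_variance_le (hv : 1 < v) :
    |v - (⌈4 * v⌉₊ : ℕ) * (1 / 4 - tParam a v ^ 2)| ≤ 1 / 4 := by
  have h := tParam_mul_lt a hv
  have ht := tParam_nonneg a hv
  have ht' := tParam_le_fifth a hv
  have hn := natCeil_eq hv
  have hd0 : 0 ≤ deltaParam v := Int.fract_nonneg _
  have hd1 : deltaParam v < 1 := Int.fract_lt_one _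
  have hs : 0 ≤ (⌈4 * v⌉₊ : ℕ) * tParam a v ^ 2 := by positivity
  have hs' : (⌈4 * v⌉₊ : ℕ) * tParam a v ^ 2 ≤ 1 / 5 := by nlinarith
  rw [abs_le]
  constructor <;> linarith

/-- The extra `1/4` from `n + 1` pays for the loss `(n + 1) t² ≤ t + t² ≤ 6/25`. -/
theorem inv_stein_const_le (hv : 1 < v) :
    1 / (((⌈4 * v⌉₊ : ℕ) + 1) * ((1 / 2 - tParam a v) * (1 - (1 / 2 - tParam a v)))) ≤ v⁻¹ := by
  have h := tParam_mul_lt a hv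
  have ht := tParam_nonneg a hv
  have ht' := tParam_le_fifth a hv
  have hn : 4 * v ≤ (⌈4 * v⌉₊ : ℕ) := Nat.le_ceil _
  rw [← one_div]
  refine one_div_le_one_div_of_le (by linarith) ?_
  nlinarith

end Parameters

/-! ### The Stein equation along the spline -/

/-- On the range of the binomial the Stein equation holds up to a skewness and a variance defect.
Off it the spline and its derivative vanish at integers, and `|w| ≥ 2v` makes the Chebyshev term `w²
/ (4v²)` at least one. -/
theorem abs_stein_error_le (a : ℝ) {v : ℝ} (hv : 1 < v) {γ : ℕ → ℝ} (hγ0 : γ 0 = 0)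
    (hγ : ∀ k, ⌈4 * v⌉₊ < k → γ k = 0) (hd : ∀ k, |γ (k + 1) - γ k| ≤ v⁻¹)
    {χ : ℝ → ℝ} {b : ℝ} (hχ : ∀ w, |χ w - b| ≤ 1)
    (heq : ∀ k : ℕ, k ≤ ⌈4 * v⌉₊ → (1 - (1 / 2 - tParam a v)) * k * γ k -
      (1 / 2 - tParam a v) * (⌈4 * v⌉₊ - k) * γ (k + 1) =
        χ (k - ⌈4 * v⌉₊ * (1 / 2 - tParam a v)) - b)
    {w : ℝ} (hw : ∃ z : ℤ, w + ⌈4 * v⌉₊ * (1 / 2 - tParam a v) = z) :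
    |χ w - b -
      (w * Spline.interp ⌈4 * v⌉₊ γ (w + ⌈4 * v⌉₊ * (1 / 2 - tParam a v)) -
        v * Spline.interp₁ ⌈4 * v⌉₊ γ (w + ⌈4 * v⌉₊ * (1 / 2 - tParam a v)))| ≤
      v⁻¹ * (tParam a v * ((1 + w ^ 2) / 2) + 1 / 4) + w ^ 2 / (4 * v ^ 2) := by
  have h := tParam_mul_lt a hv
  have ht := tParam_nonneg a hv
  have hn : 4 * v ≤ (⌈4 * v⌉₊ : ℕ) := Nat.le_ceil _
  have hvar := abs_sub_variance_le a hv
  set n := ⌈4 * v⌉₊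
  set t := tParam a v
  have hvi : 0 < v⁻¹ := by positivity
  obtain ⟨z, hz⟩ := hw
  have hout : 2 * v ≤ |w| →
      |χ w - b| ≤ v⁻¹ * (t * ((1 + w ^ 2) / 2) + 1 / 4) + w ^ 2 / (4 * v ^ 2) := by
    intro hw
    have h1 : 1 ≤ w ^ 2 / (4 * v ^ 2) := by
      rw [le_div_iff₀ (by positivity), ← sq_abs w]
      nlinarith
    have h2 : 0 ≤ v⁻¹ * (t * ((1 + w ^ 2) / 2) + 1 / 4) := by positivity
    linarith [hχ w]
  rw [hz]
  rcases lt_or_ge z 0 with hneg | hnonneg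
  · have hz1 : (z : ℝ) ≤ -1 := by exact_mod_cast Int.le_sub_one_of_lt hneg
    rw [Spline.interp_of_le hγ0 hz1, Spline.interp₁_of_le hγ0 hz1, mul_zero, mul_zero, sub_zero,
      sub_zero]
    refine hout (le_trans ?_ (neg_le_abs w))
    nlinarith
  obtain ⟨k, rfl⟩ := Int.eq_ofNat_of_zero_le hnonneg
  rw [Int.cast_natCast] at hz ⊢
  rw [Spline.interp_nat hγ, Spline.interp₁_nat hγ]
  rcases lt_or_ge n k with hkn | hkn
  · have hk1 : (n : ℝ) + 1 ≤ k := by exact_mod_cast hkn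
    rw [hγ k hkn, hγ (k + 1) (by omega)]
    simp only [add_zero, zero_div, mul_zero, sub_zero]
    refine hout (le_trans ?_ (le_abs_self w))
    nlinarith
  · have e := heq k hkn
    have hwk : w = k - n * (1 / 2 - t) := by linarith
    rw [← hwk] at e
    -- Writing `p = 1/2 - t` turns the weights `1 - p` and `p` of `γ k` and `γ (k + 1)` into an
    -- average minus `t` times the increment.
    have e2 : χ w - b - (w * ((γ k + γ (k + 1)) / 2) - v * (γ (k + 1) - γ k)) =
        (-(t * w) + (v - n * (1 / 4 - t ^ 2))) * (γ (k + 1) - γ k) := by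
      rw [← e, hwk]; ring
    rw [e2, abs_mul, mul_comm]
    have h1 : |-(t * w) + (v - n * (1 / 4 - t ^ 2))| ≤ t * ((1 + w ^ 2) / 2) + 1 / 4 := by
      refine (abs_add_le _ _).trans (add_le_add ?_ hvar)
      rw [abs_neg, abs_mul, abs_of_nonneg ht]
      refine mul_le_mul_of_nonneg_left ?_ ht
      nlinarith [sq_nonneg (|w| - 1), sq_abs w]
    have h2 := mul_le_mul (hd k) h1 (abs_nonneg _) hvi.le
    have h3 : 0 ≤ w ^ 2 / (4 * v ^ 2) := by positivity
    linarith

theorem centeredBinomial_real (n : ℕ) (p : unitInterval) {S : Set ℝ} (hS : MeasurableSet S)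
    [DecidablePred fun k : ℕ => (k : ℝ) - n * p ∈ S] :
    (centeredBinomial n p).real S =
      ∑ k ∈ (Finset.range (n + 1)).filter (fun k : ℕ => (k : ℝ) - n * p ∈ S),
        BinomialStein.weight n p k := by
  have hI : Finset.Iic n = Finset.range (n + 1) := by ext k; simp
  rw [centeredBinomial, map_measureReal_apply .of_discrete hS, binomial_eq_sum_dirac, hI,
    measureReal_def, Measure.finsetSum_apply, ENNReal.toReal_sum, Finset.sum_filter]
  · refine Finset.sum_congr rfl fun k _ => ?_
    rw [Measure.smul_apply, Measure.dirac_apply, smul_eq_mul, ENNReal.toReal_mul,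
      ENNReal.toReal_ofReal binomial_nonneg]
    by_cases h : (k : ℝ) - n * p ∈ S <;> simp [h, BinomialStein.weight]
  · intro k _
    rw [Measure.smul_apply, smul_eq_mul]
    exact ENNReal.mul_ne_top ENNReal.ofReal_ne_top (measure_ne_top _ _)

/-! ### Approximation of the total number of points -/

section Approximation

variable {Ω J : Type*} [MeasurableSpace Ω] [MeasurableSpace J] {P : Measure Ω}
  {Φ : Ω → Measure J}

theorem ae_exists_nat_totalCentred [TopologicalSpace J] (hΦ : IsSimplePointProcess Φ P)
    (hμ : meanMeasure Φ P univ < ∞) :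
    ∀ᵐ ω ∂P, ∃ k : ℕ, totalCentred Φ P ω = k - (meanMeasure Φ P univ).toReal := by
  filter_upwards [hΦ.ae_simple,
    ae_isFiniteMeasure hΦ.measurable (lintegral_univ_ne_top hΦ.measurable hμ)] with ω hs hω
  obtain ⟨k, hk⟩ := hs.integerValued univ MeasurableSet.univ
  have hne : k ≠ ⊤ := by
    rintro rfl
    exact measure_ne_top (Φ ω) univ (by rw [hk]; rfl)
  lift k to ℕ using hne
  refine ⟨k, ?_⟩
  rw [totalCentred, centred, pointCount, hk]
  simp

/-- Take expectations in the pointwise Stein error; since it is quadratic in `W`, only `E W² = σ²`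
enters. -/
theorem abs_measureReal_sub_le [IsProbabilityMeasure P] {W : Ω → ℝ} (hW : Measurable W)
    (hL2 : MemLp W 2 P) (hW0 : ∫ ω, W ω ∂P = 0) (a : ℝ) (hv : 1 < variance W P)
    (hlat : ∀ᵐ ω ∂P, ∃ k : ℕ, W ω = k + a) {S : Set ℝ} (hS : MeasurableSet S) {γ : ℕ → ℝ}
    (hγ0 : γ 0 = 0) (hγ : ∀ k, ⌈4 * variance W P⌉₊ < k → γ k = 0)
    (hd : ∀ k, |γ (k + 1) - γ k| ≤ (variance W P)⁻¹) {b : ℝ} (hb : b ∈ Icc (0 : ℝ) 1)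
    (heq : ∀ k : ℕ, k ≤ ⌈4 * variance W P⌉₊ →
      (1 - (1 / 2 - tParam a (variance W P))) * k * γ k -
      (1 / 2 - tParam a (variance W P)) * (⌈4 * variance W P⌉₊ - k) * γ (k + 1) =
        S.indicator 1 (k - ⌈4 * variance W P⌉₊ * (1 / 2 - tParam a (variance W P))) - b) :
    |(P.map W).real S - b| ≤
      |∫ ω, W ω * Spline.interp ⌈4 * variance W P⌉₊ γ
          (W ω + ⌈4 * variance W P⌉₊ * (1 / 2 - tParam a (variance W P))) ∂P -
        variance W P * ∫ ω, Spline.interp₁ ⌈4 * variance W P⌉₊ γ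
          (W ω + ⌈4 * variance W P⌉₊ * (1 / 2 - tParam a (variance W P))) ∂P| +
        1.75 * (variance W P)⁻¹ := by
  have hvar : variance W P = ∫ ω, W ω ^ 2 ∂P := variance_of_integral_eq_zero hW.aemeasurable hW0
  have hsq : Integrable (fun ω => W ω ^ 2) P := hL2.integrable_sq
  have hWint : Integrable W P := hL2.integrable one_le_two
  set v := variance W P with hvdef
  set c : ℝ := ⌈4 * v⌉₊ * (1 / 2 - tParam a v) with hc
  obtain ⟨y, hy⟩ := exists_int_mean a hv
  rw [← hc] at hy
  have hX : Measurable fun ω => W ω + c := hW.add_const c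
  obtain ⟨C, hC⟩ := Spline.exists_bound_interp (n := ⌈4 * v⌉₊) (γ := γ)
  obtain ⟨C₁, hC₁⟩ := Spline.exists_bound_interp₁ (n := ⌈4 * v⌉₊) (γ := γ)
  have i1 : Integrable (fun ω => W ω * Spline.interp ⌈4 * v⌉₊ γ (W ω + c)) P :=
    hWint.mul_bdd (c := C) (Spline.continuous_interp.measurable.comp hX).aestronglyMeasurable
      (.of_forall fun _ => hC _)
  have i2 : Integrable (fun ω => Spline.interp₁ ⌈4 * v⌉₊ γ (W ω + c)) P :=
    Integrable.of_bound (Spline.continuous_interp₁.measurable.comp hX).aestronglyMeasurable C₁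
      (.of_forall fun _ => hC₁ _)
  have i3 : Integrable (fun ω => S.indicator (1 : ℝ → ℝ) (W ω)) P :=
    Integrable.of_bound ((measurable_one.indicator hS).comp hW).aestronglyMeasurable 1
      (.of_forall fun ω => by by_cases h : W ω ∈ S <;> simp [h])
  have hP : (P.map W).real S = ∫ ω, S.indicator (1 : ℝ → ℝ) (W ω) ∂P := by
    rw [← integral_indicator_one hS, integral_map hW.aemeasurable
      (measurable_one.indicator hS).aestronglyMeasurable]
  have i4 : Integrable (fun ω => v⁻¹ * (tParam a v * ((1 + W ω ^ 2) / 2) + 1 / 4) +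
      W ω ^ 2 / (4 * v ^ 2)) P :=
    (((((integrable_const (1 : ℝ)).add hsq).div_const 2).const_mul _).add
      (integrable_const _)).const_mul _ |>.add (hsq.div_const _)
  have hbound : |∫ ω, (S.indicator (1 : ℝ → ℝ) (W ω) - b -
      (W ω * Spline.interp ⌈4 * v⌉₊ γ (W ω + c) - v * Spline.interp₁ ⌈4 * v⌉₊ γ (W ω + c))) ∂P| ≤
      ∫ ω, (v⁻¹ * (tParam a v * ((1 + W ω ^ 2) / 2) + 1 / 4) + W ω ^ 2 / (4 * v ^ 2)) ∂P := by
    rw [← Real.norm_eq_abs]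
    refine norm_integral_le_of_norm_le i4 ?_
    filter_upwards [hlat] with ω ⟨k, hk⟩
    refine abs_stein_error_le a hv hγ0 hγ hd (fun w => ?_) heq ⟨k + y, ?_⟩
    · rw [abs_le]
      by_cases h : w ∈ S <;> simp only [h, indicator_of_mem, indicator_of_notMem, Pi.one_apply,
        not_false_eq_true] <;> constructor <;> linarith [hb.1, hb.2]
    · push_cast
      rw [← hc, hk, hy]
      ring
  have hlhs : ∫ ω, (S.indicator (1 : ℝ → ℝ) (W ω) - b -
      (W ω * Spline.interp ⌈4 * v⌉₊ γ (W ω + c) - v * Spline.interp₁ ⌈4 * v⌉₊ γ (W ω + c))) ∂P =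
      (P.map W).real S - b - (∫ ω, W ω * Spline.interp ⌈4 * v⌉₊ γ (W ω + c) ∂P -
        v * ∫ ω, Spline.interp₁ ⌈4 * v⌉₊ γ (W ω + c) ∂P) := by
    rw [integral_sub (i3.sub' (integrable_const b)) (i1.sub' (i2.const_mul v)),
      integral_sub i3 (integrable_const b), integral_sub i1 (i2.const_mul v), integral_const_mul,
      integral_const, probReal_univ, one_smul, hP]
  have hrhs : ∫ ω, (v⁻¹ * (tParam a v * ((1 + W ω ^ 2) / 2) + 1 / 4) + W ω ^ 2 / (4 * v ^ 2)) ∂P =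
      v⁻¹ * (tParam a v * ((1 + v) / 2) + 1 / 4) + v / (4 * v ^ 2) := by
    have e : ∀ ω, v⁻¹ * (tParam a v * ((1 + W ω ^ 2) / 2) + 1 / 4) + W ω ^ 2 / (4 * v ^ 2) =
        v⁻¹ * (tParam a v / 2 + 1 / 4) + (v⁻¹ * tParam a v / 2 + 1 / (4 * v ^ 2)) * W ω ^ 2 :=
      fun ω => by ring
    simp only [e]
    rw [integral_add (integrable_const _) (hsq.const_mul _), integral_const, integral_const_mul,
      probReal_univ, one_smul, ← hvar]
    ring
  rw [hlhs, hrhs] at hbound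
  -- Skewness, variance defect and Chebyshev term contribute at most `1/4` each, in units of `v⁻¹`.
  have hnum : v⁻¹ * (tParam a v * ((1 + v) / 2) + 1 / 4) + v / (4 * v ^ 2) ≤ 1.75 * v⁻¹ := by
    have hv0 : 0 < v := by linarith
    have e : v / (4 * v ^ 2) = v⁻¹ * (1 / 4) := by field_simp
    have ht : tParam a v * ((1 + v) / 2) ≤ 1 / 4 := by
      calc tParam a v * ((1 + v) / 2) ≤ 1 / (4 * v) * v :=
            mul_le_mul (tParam_le a hv) (by linarith) (by linarith) (by positivity)
        _ = 1 / 4 := by field_simp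
    rw [e, ← mul_add, mul_comm 1.75]
    exact mul_le_mul_of_nonneg_left (by norm_num; linarith) (inv_nonneg.2 hv0.le)
  have := abs_sub_abs_le_abs_sub ((P.map W).real S - b)
    (∫ ω, W ω * Spline.interp ⌈4 * v⌉₊ γ (W ω + c) ∂P -
        v * ∫ ω, Spline.interp₁ ⌈4 * v⌉₊ γ (W ω + c) ∂P)
  linarith

theorem ofReal_abs_measureReal_sub_le [TopologicalSpace J] [IsProbabilityMeasure P]
    (hΦ : IsSimplePointProcess Φ P) (hμ : meanMeasure Φ P univ < ∞)
    {κ : Kernel J (Measure J)} [IsMarkovKernel κ] (hκ : IsPalmKernel Φ P κ)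
    {A B : J → Set J} (hA : ∀ α, MeasurableSet (A α)) (hB : ∀ α, MeasurableSet (B α))
    (hAB : ∀ α, A α ⊆ B α)
    (hlawA : ∀ᵐ α ∂(meanMeasure Φ P),
      (κ α).map (fun ν => ν (A α)ᶜ) = P.map (fun ω => Φ ω (A α)ᶜ))
    (hlawB : ∀ᵐ α ∂(meanMeasure Φ P),
      (κ α).map (fun ν => ν (B α)ᶜ) = P.map (fun ω => Φ ω (B α)ᶜ))
    (hindepPalm : ∀ᵐ α ∂(meanMeasure Φ P),
      IndepFun (fun ν : Measure J => ν (A α)) (fun ν : Measure J => ν (B α)ᶜ) (κ α))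
    (hindep : ∀ᵐ α ∂(meanMeasure Φ P),
      IndepFun (fun ω => Φ ω (A α)) (fun ω => Φ ω (B α)ᶜ) P)
    (hσ : 1 < variance (totalCentred Φ P) P) {S : Set ℝ} (hS : MeasurableSet S) {l : ℕ}
    (hl : l = 1 ∨ l = 2 ∧ ∀ s : ℝ, {k : ℕ | (k : ℝ) - s ∈ S}.Subsingleton) :
    ENNReal.ofReal |(P.map (totalCentred Φ P)).real S -
        (centeredBinomial ⌈4 * variance (totalCentred Φ P) P⌉₊
          (successProb (-(meanMeasure Φ P univ).toReal) (variance (totalCentred Φ P) P) hσ)).real S|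
      ≤ ENNReal.ofReal (variance (totalCentred Φ P) P)⁻¹ *
            ∫⁻ α, theta l Φ P (κ α) (A α) (B α) ∂(meanMeasure Φ P)
          + ENNReal.ofReal (1.75 * (variance (totalCentred Φ P) P)⁻¹) := by
  classical
  have hWm : Measurable (totalCentred Φ P) := measurable_centred hΦ.measurable MeasurableSet.univ
  have hW0 : ∫ ω, totalCentred Φ P ω ∂P = 0 :=
    integral_centred hΦ.measurable hμ MeasurableSet.univ
  -- A nonzero real-valued variance forces square integrability.
  have hL2 : MemLp (totalCentred Φ P) 2 P :=
    memLp_two_of_variance_ne_zero hWm.aestronglyMeasurable (by linarith)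
  have hlat := ae_exists_nat_totalCentred hΦ hμ
  have hstein := fun F F₁ hF => ofReal_abs_stein_le (l := l) (F := F) (F₁ := F₁) hΦ.measurable hμ hκ
    hA hB hAB hlawA hlawB hindepPalm hindep hL2 (inv_nonneg.2 (zero_le_one.trans hσ.le)) hF
  have happrox := fun γ => abs_measureReal_sub_le (γ := γ) hWm hL2 hW0
    (-(meanMeasure Φ P univ).toReal) hσ hlat hS
  rw [centeredBinomial_real _ _ hS]
  set v := variance (totalCentred Φ P) P with hv
  set a := -(meanMeasure Φ P univ).toReal with ha
  have hcoe : (successProb a v hσ : ℝ) = 1 / 2 - tParam a v := rfl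
  rw [hcoe]
  set p : ℝ := 1 / 2 - tParam a v with hp
  have hp0 : 0 < p := by linarith [tParam_le_fifth a hσ]
  have hp1 : p < 1 := by linarith [tParam_nonneg a hσ]
  -- Only the points of the binomial support falling in `S` enter the Stein equation; for `l = 2`
  -- there is at most one of them, which activates the bound on `γ` itself.
  set T := (Finset.range (⌈4 * v⌉₊ + 1)).filter (fun k : ℕ => (k : ℝ) - ⌈4 * v⌉₊ * p ∈ S) with hT
  obtain ⟨γ, hγ0, hγ, heq, hd, hbdd⟩ :=
    BinomialStein.exists_solution hp0 hp1 T (Finset.filter_subset _ _)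
  have hconst := inv_stein_const_le a hσ
  rw [← hp] at hconst
  have hb : ∑ j ∈ T, BinomialStein.weight ⌈4 * v⌉₊ p j ∈ Icc (0 : ℝ) 1 := by
    refine ⟨Finset.sum_nonneg fun j _ => BinomialStein.weight_nonneg hp0 hp1 j, ?_⟩
    rw [← BinomialStein.sum_weight ⌈4 * v⌉₊ p]
    exact Finset.sum_le_sum_of_subset_of_nonneg (Finset.filter_subset _ _)
      fun j _ _ => BinomialStein.weight_nonneg hp0 hp1 j
  have hd' : ∀ k, |γ (k + 1) - γ k| ≤ v⁻¹ := fun k => (hd k).trans hconst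
  have hF : IsSmoothTest l v⁻¹ (Spline.interp ⌈4 * v⌉₊ γ) (Spline.interp₁ ⌈4 * v⌉₊ γ) := by
    refine isSmoothTest_interp hγ0 hγ hd' (hl.imp_right fun h => ⟨h.1, fun k => ?_⟩)
    refine (hbdd (Finset.card_le_one.2 fun i hi j hj => ?_) k).trans hconst
    exact h.2 (⌈4 * v⌉₊ * p) (Finset.mem_filter.1 hi).2 (Finset.mem_filter.1 hj).2
  have h1 := happrox γ hγ0 hγ hd' hb fun k hk => by
    rw [heq k hk]
    congr 1
    by_cases h : (k : ℝ) - ⌈4 * v⌉₊ * p ∈ S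
    · rw [if_pos (Finset.mem_filter.2 ⟨Finset.mem_range.2 (by omega), h⟩), indicator_of_mem h,
        Pi.one_apply]
    · have hkT : k ∉ T := fun h' => h (Finset.mem_filter.1 h').2
      rw [if_neg hkT, indicator_of_notMem h]
  refine (ENNReal.ofReal_le_ofReal h1).trans ?_
  rw [ENNReal.ofReal_add (abs_nonneg _) (by positivity)]
  exact add_le_add_left (hstein _ _ (hF.shift (⌈4 * v⌉₊ * p))) _

end Approximation

end

/-! ### Conclusion for both metrics -/

theorem theorem3p3 {J Ω : Type*} [TopologicalSpace J] [PolishSpace J] [MeasurableSpace J]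
    [BorelSpace J] [MeasurableSpace Ω] (P : Measure Ω) [IsProbabilityMeasure P]
    (Φ : Ω → Measure J) (hΦ : IsSimplePointProcess Φ P)
    (hμ : meanMeasure Φ P univ < ∞)
    (κ : Kernel J (Measure J)) [IsMarkovKernel κ] (hκ : IsPalmKernel Φ P κ)
    (A B : J → Set J) (hA : ∀ α, MeasurableSet (A α)) (hB : ∀ α, MeasurableSet (B α))
    (hAB : ∀ α, A α ⊆ B α)
    -- the numbers of points outside `A_α` and outside `B_α` have the same law under `Φ_α` and `Φ`
    (hlawA : ∀ᵐ α ∂(meanMeasure Φ P),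
      (κ α).map (fun ν => ν (A α)ᶜ) = P.map (fun ω => Φ ω (A α)ᶜ))
    (hlawB : ∀ᵐ α ∂(meanMeasure Φ P),
      (κ α).map (fun ν => ν (B α)ᶜ) = P.map (fun ω => Φ ω (B α)ᶜ))
    (hindepPalm : ∀ᵐ α ∂(meanMeasure Φ P),
      IndepFun (fun ν : Measure J => ν (A α)) (fun ν : Measure J => ν (B α)ᶜ) (κ α))
    (hindep : ∀ᵐ α ∂(meanMeasure Φ P),
      IndepFun (fun ω => Φ ω (A α)) (fun ω => Φ ω (B α)ᶜ) P)
    -- `σ² = Var W > 1`; Mathlib's real variance is `0` when the variance is infinite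
    (hσ : 1 < variance (totalCentred Φ P) P) :
    ∀ l : ℕ, l = 1 ∨ l = 2 →
      dMetric l (P.map (totalCentred Φ P))
          (centeredBinomial ⌈4 * variance (totalCentred Φ P) P⌉₊
            (successProb (-(meanMeasure Φ P univ).toReal) (variance (totalCentred Φ P) P) hσ)) ≤
        ENNReal.ofReal (variance (totalCentred Φ P) P)⁻¹ *
            ∫⁻ α, theta l Φ P (κ α) (A α) (B α) ∂(meanMeasure Φ P)
          + ENNReal.ofReal (1.75 * (variance (totalCentred Φ P) P)⁻¹) := by
  rintro l (rfl | rfl)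
  · rw [dMetric, if_pos rfl]
    exact iSup₂_le fun S hS => ofReal_abs_measureReal_sub_le hΦ hμ hκ hA hB hAB hlawA hlawB
      hindepPalm hindep hσ hS (Or.inl rfl)
  · rw [dMetric, if_neg (by norm_num)]
    -- A half-open interval of length one meets each translate of the integers in a single point, so
    -- at most one natural number qualifies.
    refine iSup_le fun x => ofReal_abs_measureReal_sub_le hΦ hμ hκ hA hB hAB hlawA hlawB
      hindepPalm hindep hσ measurableSet_Ico (Or.inr ⟨rfl, fun s i hi j hj => ?_⟩)
    simp only [mem_ofPred_eq, mem_Ico] at hi hj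
    have h1 : (i : ℝ) < j + 1 := by linarith
    have h2 : (j : ℝ) < i + 1 := by linarith
    have h1' : i < j + 1 := by exact_mod_cast h1
    have h2' : j < i + 1 := by exact_mod_cast h2
    omega
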